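/- Let $\mathbb N=\{1,2,\dots\}$. An infinite binary information system is a pair $U=(A,F)$, where $A$ is an infinite set and $F$ is an infinite set of functions (attributes) $A\to\{0,1\}$. A problem over $U$ is a tuple $z=(\nu,f_1,\dots,f_n)$ with $n\in\mathbb N$, $\nu:\{0,1\}^n\to\mathbb N$ and $f_1,\dots,f_n\in F$; put $z(a)=\nu(f_1(a),\dots,f_n(a))$ for $a \in A$ and $\dim z=n$. A decision tree over $U$ is a finite directed rooted tree in which the root and the (at least one) edges leaving it are unlabelled, each terminal node is labelled with a number from $\mathbb N$, each other non-root node (working node) is labelled with an attribute from $F$, and each edge leaving a working node is labelled with $0$ or $1$. It is deterministic if exactly one edge leaves the root and edges leaving the same working node have different labels. A complete path $\xi$ is a directed path from the root to a terminal node, and $A(\xi)$ is the set of $a\in A$ such that $f(a)=\delta$ for every working node of $\xi$, where $f$ is its label and $\delta$ is the label of the edge of $\xi$ leaving it. A tree solves $z$ nondeterministically if every $a\in A$ lies in $A(\xi)$ for some complete path $\xi$ and, whenever $a\in A(\xi)$, the terminal node of $\xi$ is labelled $z(a)$; it solves $z$ deterministically if in addition it is deterministic. The depth of a tree is the maximum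 number of working nodes in a complete path. Let $h^d_U(z)$ and $L^d_U(z)$ (respectively $h^a_U(z)$ and $L^a_U(z)$) be the minimum depth and the minimum number of nodes (including the root) of a decision tree over $U$ solving $z$ deterministically (respectively nondeterministically), and for $n\in\mathbb N$ let $h^d_U(n),h^a_U(n),L^d_U(n),L^a_U(n)$ be the maxima of these values over all problems $z$ over $U$ with $\dim z\le n$. For $m\in\mathbb N$, an $(m,U)$-set is a nonempty solution set in $A$ of a system $\{f_1(x)=\delta_1,\dots,f_m(x)=\delta_m\}$ with $f_i\in F$ (not necessarily different) and $\delta_i\in\{0,1\}$. $U$ satisfies the condition of coverage if for some $m\in\mathbb N$ every $(m+1,U)$-set is a union of finitely many $(m,U)$-sets, and the condition of restricted coverage if for some $m,t\in\mathbb N$ every $(m+1,U)$-set is a union of at most $t$ $(m,U)$-sets. A finite set $S\subseteq F$ is independent if for every choice of $\delta_f\in\{0,1\}$, $f\in S$, the system $\{f(x)=\delta_f : f\in S\}$ has a solution in $A$; $I(U)\in\{0,1,\dots\}\cup\{\infty\}$ is the supremum of the cardinalities of independent subsets of $F$. Types of behavior. The function $h^d_U$ has type LOG if for every $\varepsilon\in(0,1)$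 there is $c>0$ with $\log_2(n+1)\le h^d_U(n)\le c(\log_2 n)^{1+\varepsilon}+1$ for all $n\in\mathbb N$, and type LIN if $h^d_U(n)=n$ for all $n\in\mathbb N$. The function $h^a_U$ has type CON if it is bounded from above by a constant, and type LIN if $h^a_U(n)=n$ for all $n\in\mathbb N$. A function $L\in\{L^d_U,L^a_U\}$ has type POL if $I(U)<\infty$ and $2(n+1)\le L(n)\le 2(4n)^{I(U)}$ for all $n\in\mathbb N$, and type EXP if $L(n)=2^{n+1}$ for all $n\in\mathbb N$. The type of $U$ is the tuple of types of $(h^d_U,h^a_U,L^d_U,L^a_U)$. **Theorem 1.** (a) Every infinite binary information system $U$ has exactly one type, and this type is one of the five rows 1. (LOG, CON, POL, POL), 2. (LIN, CON, POL, POL), 3. (LIN, LIN, POL, POL), 4. (LIN, CON, EXP, EXP), 5. (LIN, LIN, EXP, EXP). Here $h^d_U$ has type LOG if and only if $I(U)<\infty$ and $U$ satisfies the condition of restricted coverage, $h^a_U$ has type CON if and only if $U$ satisfies the condition of coverage, and $L^d_U$ (equivalently $L^a_U$) has type POL if and only if $I(U)<\infty$. (b) Each row is the type of some infinite binary information system.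 For $i,j\in\mathbb N$ let $p_i(j)=1$ iff $j=i$, and $l_i(j)=1$ iff $j>i$ (and $0$ otherwise). Then rows $1,\dots,5$ are, respectively, the types of $U_1=(\mathbb N,\{l_i:i\in\mathbb N\})$; $U_2=(\mathbb N,\{p_i:i\in\mathbb N\}\cup\{l_{2^i}:i\in\mathbb N\})$; $U_3=(\mathbb N,\{p_i:i\in\mathbb N\})$; $U_4=(\mathbb N,\text{all functions }\mathbb N\to\{0,1\})$; and $U_5=(\{0,1\}^{\mathbb N},\{f_i:i\in\mathbb N\})$ with $f_i(a_1,a_2,\dots)=a_i$. -/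

import Mathlib

universe u

/-- An infinite binary information system `U = (A, F)`: an infinite set `A` of objects (the universe)
and an infinite set `F` of attributes, i.e. functions from `A` to `{0,1}`
(`false` is `0`, `true` is `1`). -/
structure InfoSystem where
  /-- the universe -/
  A : Type u
  /-- the set of attributes -/
  F : Set (A → Bool)
  infinite_A : Infinite A
  infinite_F : F.Infinite

/-- A subtree of a decision tree hanging below an edge, with working nodes labelled by elements of
`α`. It is a terminal node labelled with a positive integer, or a working node labelled
with an attribute, with `k + 1 ≥ 1` leaving edges; the `i`-th edge is labelled with the bit
`label i` and enters the root of the subtree `child i`. Several edges may have the same label. -/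
inductive TreeNode (α : Type u) : Type u
  | terminal (d : ℕ+) : TreeNode α
  | working (f : α) (k : ℕ) (label : Fin (k + 1) → Bool)
      (child : Fin (k + 1) → TreeNode α) : TreeNode α

namespace TreeNode

variable {α : Type u}

/-- The maximum number of working nodes on a path to a terminal node. -/
def depth : TreeNode α → ℕ
  | terminal _ => 0
  | working _ _ _ child => 1 + Finset.univ.sup fun i => (child i).depth

/-- The number of nodes. -/
def size : TreeNode α → ℕ
  | terminal _ => 1
  | working _ _ _ child => 1 + ∑ i, (child i).size

/-- Edges leaving one and the same working node have pairwise different labels. -/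
def Deterministic : TreeNode α → Prop
  | terminal _ => True
  | working _ _ label child => Function.Injective label ∧ ∀ i, (child i).Deterministic

/-- `t.IsPath ξ d`: there is a directed path in `t` from its root to a terminal node labelled `d`
along which the working nodes and the edges leaving them carry the successive labels
listed in `ξ`. -/
inductive IsPath : TreeNode α → List (α × Bool) → ℕ+ → Prop
  | terminal (d : ℕ+) : IsPath (terminal d) [] d
  | working (f : α) (k : ℕ) (label : Fin (k + 1) → Bool) (child : Fin (k + 1) → TreeNode α)
      (i : Fin (k + 1)) (ξ : List (α × Bool)) (d : ℕ+) (h : IsPath (child i) ξ d) :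
      IsPath (working f k label child) ((f, label i) :: ξ) d

end TreeNode

/-- A decision tree: an unlabelled root with `k + 1 ≥ 1` leaving unlabelled edges. -/
structure DecisionTree (α : Type u) where
  k : ℕ
  child : Fin (k + 1) → TreeNode α

namespace DecisionTree

variable {α : Type u}

/-- The maximum number of working nodes in a complete path. -/
def depth (Γ : DecisionTree α) : ℕ := Finset.univ.sup fun i => (Γ.child i).depth

/-- The number of nodes, the root included. -/
def size (Γ : DecisionTree α) : ℕ := 1 + ∑ i, (Γ.child i).size

/-- Exactly one edge leaves the root, and edges leaving a working node have different labels. -/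
def Deterministic (Γ : DecisionTree α) : Prop := Γ.k = 0 ∧ ∀ i, (Γ.child i).Deterministic

/-- Complete paths: from the root to a terminal node labelled `d`. -/
def IsPath (Γ : DecisionTree α) (ξ : List (α × Bool)) (d : ℕ+) : Prop :=
  ∃ i, (Γ.child i).IsPath ξ d

end DecisionTree

namespace InfoSystem

/-- A problem `z = (ν, f₁, …, fₙ)` over `U`, `n ≥ 1`. -/
structure Problem (U : InfoSystem.{u}) where
  dim : ℕ
  dim_pos : 1 ≤ dim
  ν : (Fin dim → Bool) → ℕ+
  f : Fin dim → U.F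

/-- `z(a) = ν (f₁ a, …, fₙ a)`. -/
def Problem.value {U : InfoSystem.{u}} (z : U.Problem) (a : U.A) : ℕ+ :=
  z.ν fun i => (z.f i).1 a

variable (U : InfoSystem.{u})

/-- Decision trees over `U`: working nodes are labelled with attributes of `U`. -/
abbrev Tree : Type u := DecisionTree U.F

/-- The set `A(ξ)` of solutions of the equations read along a complete path. -/
def solutions (ξ : List (U.F × Bool)) : Set U.A := {a | ∀ e ∈ ξ, e.1.1 a = e.2}

variable {U}

/-- `Γ` solves `z` nondeterministically. -/
def SolvesNondet (Γ : U.Tree) (z : U.Problem) : Prop :=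
  (∀ a, ∃ ξ d, Γ.IsPath ξ d ∧ a ∈ U.solutions ξ) ∧
    ∀ a ξ d, Γ.IsPath ξ d → a ∈ U.solutions ξ → d = z.value a

/-- `Γ` solves `z` deterministically. -/
def SolvesDet (Γ : U.Tree) (z : U.Problem) : Prop := Γ.Deterministic ∧ SolvesNondet Γ z

/-- Minimum depth of a decision tree over `U` solving `z` deterministically. -/
noncomputable def Problem.hd (z : U.Problem) : ℕ∞ :=
  ⨅ (Γ : U.Tree) (_ : SolvesDet Γ z), (Γ.depth : ℕ∞)

/-- Minimum depth of a decision tree over `U` solving `z` nondeterministically. -/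
noncomputable def Problem.ha (z : U.Problem) : ℕ∞ :=
  ⨅ (Γ : U.Tree) (_ : SolvesNondet Γ z), (Γ.depth : ℕ∞)

/-- Minimum number of nodes of a decision tree over `U` solving `z` deterministically. -/
noncomputable def Problem.Ld (z : U.Problem) : ℕ∞ :=
  ⨅ (Γ : U.Tree) (_ : SolvesDet Γ z), (Γ.size : ℕ∞)

/-- Minimum number of nodes of a decision tree over `U` solving `z` nondeterministically. -/
noncomputable def Problem.La (z : U.Problem) : ℕ∞ :=
  ⨅ (Γ : U.Tree) (_ : SolvesNondet Γ z), (Γ.size : ℕ∞)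

variable (U)

/-- `h_U^d(n)`: worst case of `hd z` over problems of dimension at most `n`. The values are taken
in `ℕ∞`, where a supremum of a nonempty set that is finite is a maximum. -/
noncomputable def hd (n : ℕ) : ℕ∞ := ⨆ (z : U.Problem) (_ : z.dim ≤ n), z.hd

/-- `h_U^a(n)` -/
noncomputable def ha (n : ℕ) : ℕ∞ := ⨆ (z : U.Problem) (_ : z.dim ≤ n), z.ha

/-- `L_U^d(n)` -/
noncomputable def Ld (n : ℕ) : ℕ∞ := ⨆ (z : U.Problem) (_ : z.dim ≤ n), z.Ld

/-- `L_U^a(n)` -/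
noncomputable def La (n : ℕ) : ℕ∞ := ⨆ (z : U.Problem) (_ : z.dim ≤ n), z.La

/-- `B` is an `(m,U)`-set: a nonempty solution set of a system of `m` equations
`f₁(x) = δ₁, …, fₘ(x) = δₘ` with (not necessarily different) attributes of `U`. -/
def IsMSet (m : ℕ) (B : Set U.A) : Prop :=
  B.Nonempty ∧ ∃ (f : Fin m → U.F) (δ : Fin m → Bool), B = {a | ∀ i, (f i).1 a = δ i}

/-- The condition of coverage. -/
def Coverage : Prop :=
  ∃ m : ℕ, 1 ≤ m ∧ ∀ B, U.IsMSet (m + 1) B →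
    ∃ C : Set (Set U.A), C.Finite ∧ (∀ D ∈ C, U.IsMSet m D) ∧ B = ⋃₀ C

/-- The condition of restricted coverage. -/
def RestrictedCoverage : Prop :=
  ∃ m t : ℕ, 1 ≤ m ∧ 1 ≤ t ∧ ∀ B, U.IsMSet (m + 1) B →
    ∃ C : Set (Set U.A), C.encard ≤ t ∧ (∀ D ∈ C, U.IsMSet m D) ∧ B = ⋃₀ C

/-- A finite set `S` of attributes is independent if every system of equations
`f(x) = δ_f`, `f ∈ S`, has a solution. -/
def Independent (S : Finset (U.A → Bool)) : Prop :=
  ∀ δ : (U.A → Bool) → Bool, ∃ a, ∀ f ∈ S, f a = δ f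

/-- The independence dimension `I(U)`. -/
noncomputable def iDim : ℕ∞ :=
  ⨆ (S : Finset (U.A → Bool)) (_ : (S : Set (U.A → Bool)) ⊆ U.F ∧ U.Independent S), (S.card : ℕ∞)

end InfoSystem

/-- Types of behavior of `h_U^d`. -/
inductive DetDepthType
  | LOG
  | LIN

/-- Types of behavior of `h_U^a`. -/
inductive NondetDepthType
  | CON
  | LIN

/-- Types of behavior of `L_U^d` and `L_U^a`. -/
inductive SizeType
  | POL
  | EXP

/-- A tuple of types of behavior of `h_U^d`, `h_U^a`, `L_U^d`, `L_U^a` (16 possibilities). -/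
structure SystemType where
  hd : DetDepthType
  ha : NondetDepthType
  Ld : SizeType
  La : SizeType

/-- The deterministic depth function `h` has the given type of behavior. -/
def DetDepthType.Describes (h : ℕ → ℕ∞) : DetDepthType → Prop
  | LOG => ∀ ε : ℝ, 0 < ε → ε < 1 → ∃ c : ℝ, 0 < c ∧ ∀ n : ℕ, 1 ≤ n → ∃ k : ℕ, h n = k ∧
      Real.logb 2 (n + 1) ≤ k ∧ (k : ℝ) ≤ c * Real.logb 2 n ^ (1 + ε) + 1
  | LIN => ∀ n : ℕ, 1 ≤ n → h n = n

/-- The nondeterministic depth function `h` has the given type of behavior. -/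
def NondetDepthType.Describes (h : ℕ → ℕ∞) : NondetDepthType → Prop
  | CON => ∃ c : ℕ, 0 < c ∧ ∀ n : ℕ, 1 ≤ n → h n ≤ c
  | LIN => ∀ n : ℕ, 1 ≤ n → h n = n

/-- The size function `L` has the given type of behavior; `I` is the independence dimension. -/
def SizeType.Describes (I : ℕ∞) (L : ℕ → ℕ∞) : SizeType → Prop
  | POL => ∃ d : ℕ, I = d ∧ ∀ n : ℕ, 1 ≤ n →
      ((2 * (n + 1) : ℕ) : ℕ∞) ≤ L n ∧ L n ≤ ((2 * (4 * n) ^ d : ℕ) : ℕ∞)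
  | EXP => ∀ n : ℕ, 1 ≤ n → L n = ((2 ^ (n + 1) : ℕ) : ℕ∞)

/-- The four functions of `U` have the types of behavior listed in `τ`. -/
def InfoSystem.HasType (U : InfoSystem.{u}) (τ : SystemType) : Prop :=
  τ.hd.Describes U.hd ∧ τ.ha.Describes U.ha ∧
    τ.Ld.Describes U.iDim U.Ld ∧ τ.La.Describes U.iDim U.La

/-- The five rows of the table of types. -/
def typeTable : Fin 5 → SystemType :=
  ![⟨.LOG, .CON, .POL, .POL⟩,
    ⟨.LIN, .CON, .POL, .POL⟩,
    ⟨.LIN, .LIN, .POL, .POL⟩,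
    ⟨.LIN, .CON, .EXP, .EXP⟩,
    ⟨.LIN, .LIN, .EXP, .EXP⟩]

/-- `pᵢ(j) = 1` iff `j = i`. -/
def pAttr (i : ℕ+) : ℕ+ → Bool := fun j => decide (j = i)

/-- `lᵢ(j) = 1` iff `j > i`. -/
def lAttr (i : ℕ+) : ℕ+ → Bool := fun j => decide (i < j)

theorem pAttr_injective : Function.Injective pAttr := by
  intro i j h
  have := congrFun h i
  simpa [pAttr] using this

theorem lAttr_injective : Function.Injective lAttr := by
  intro i j h
  have h1 := congrFun h i
  have h2 := congrFun h j
  simp only [lAttr, lt_irrefl, decide_false] at h1 h2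
  have h1' : ¬ j < i := by simpa using h1.symm
  have h2' : ¬ i < j := by simpa using h2
  exact le_antisymm (not_lt.mp h1') (not_lt.mp h2')

/-- The `i`-th coordinate of an infinite binary sequence. -/
def coordAttr (i : ℕ+) : (ℕ+ → Bool) → Bool := fun a => a i

theorem coordAttr_injective : Function.Injective coordAttr := by
  intro i j h
  have := congrFun h (pAttr j)
  simpa [coordAttr, pAttr] using this

/-- `U₁ = (ℕ, {lᵢ})` -/
def U₁ : InfoSystem.{0} where
  A := ℕ+
  F := Set.range lAttr
  infinite_A := inferInstance
  infinite_F := Set.infinite_range_of_injective lAttr_injective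

/-- `U₂ = (ℕ, {pᵢ} ∪ {l_{2^i}})` -/
def U₂ : InfoSystem.{0} where
  A := ℕ+
  F := Set.range pAttr ∪ Set.range fun i : ℕ+ => lAttr (2 ^ (i : ℕ))
  infinite_A := inferInstance
  infinite_F := (Set.infinite_range_of_injective pAttr_injective).mono Set.subset_union_left

/-- `U₃ = (ℕ, {pᵢ})` -/
def U₃ : InfoSystem.{0} where
  A := ℕ+
  F := Set.range pAttr
  infinite_A := inferInstance
  infinite_F := Set.infinite_range_of_injective pAttr_injective

/-- `U₄ = (ℕ, all functions ℕ → {0,1})` -/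
def U₄ : InfoSystem.{0} where
  A := ℕ+
  F := Set.univ
  infinite_A := inferInstance
  infinite_F := (Set.infinite_range_of_injective pAttr_injective).mono (Set.subset_univ _)

/-- `U₅`: infinite binary sequences with the coordinate functions. -/
def U₅ : InfoSystem.{0} where
  A := ℕ+ → Bool
  F := Set.range coordAttr
  infinite_A := Infinite.of_injective pAttr pAttr_injective
  infinite_F := Set.infinite_range_of_injective coordAttr_injective

/-!
An object `a` is regarded as the Boolean function `f ↦ f a` on the set of attributes, and a system
`U` as the class of these functions.

Number of nodes. A tree that solves `z` has at least twice as many nodes as `z` has values, and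
querying the attributes of `z` one by one needs at most twice as many nodes as there are patterns
on these attributes. The largest number of patterns on `n` attributes is at least `n + 1`; it is
`2 ^ n` if `I(U) = ∞`, and polynomial in `n` by the Sauer–Shelah bound if `I(U) < ∞`.

Linear depth. A tree of depth at most `m` for the problem that singles out the solutions of `m + 1`
equations writes this `(m + 1, U)`-set as a union of `(m, U)`-sets, one for each path with the
corresponding label: finitely many in general, and at most `2 ^ m` if the tree is deterministic.

Logarithmic depth. Let `I(U) < ∞`, and let `U` satisfy the condition of restricted coverage. Every
finite set `X` of attributes lies in a certificate: a finite set `G` such that an assignment on `G`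
that is consistent on every few attributes contains `m` equations that imply all its values on `X`.
Building certificates for larger sets out of certificates for their parts keeps the logarithm of
their size below `c * (log n) ^ (1 + ε)`. With a certificate at hand, a query either discards a
constant proportion of the polynomially many patterns on `G`, or the majority answers are
consistent on every few attributes and querying the decisive `m` of them settles the rest.
-/

section Equations

variable {α : Type u}

/-- `δ` satisfies the system of equations `f(x) = y`, one for each pair `(f, y)` listed in `ξ`. -/
def Satisfies (δ : α → Bool) (ξ : List (α × Bool)) : Prop := ∀ e ∈ ξ, δ e.1 = e.2

@[simp]
theorem satisfies_nil (δ : α → Bool) : Satisfies δ [] := by simp [Satisfies]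

@[simp]
theorem satisfies_cons {δ : α → Bool} {e : α × Bool} {ξ : List (α × Bool)} :
    Satisfies δ (e :: ξ) ↔ δ e.1 = e.2 ∧ Satisfies δ ξ := by
  simp [Satisfies]

end Equations

namespace TreeNode

variable {α : Type u}

/-- The set of root-to-terminal paths of `t`, with the labels of their terminal nodes. -/
def paths (t : TreeNode α) : Set (List (α × Bool) × ℕ+) := {p | t.IsPath p.1 p.2}

theorem isPath_terminal_iff {d d' : ℕ+} {ξ : List (α × Bool)} :
    (terminal d : TreeNode α).IsPath ξ d' ↔ ξ = [] ∧ d' = d := by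
  constructor
  · rintro ⟨⟩
    exact ⟨rfl, rfl⟩
  · rintro ⟨rfl, rfl⟩
    exact .terminal _

theorem isPath_working_iff {f : α} {k : ℕ} {label : Fin (k + 1) → Bool}
    {child : Fin (k + 1) → TreeNode α} {ξ : List (α × Bool)} {d : ℕ+} :
    (working f k label child).IsPath ξ d ↔
      ∃ i ξ', ξ = (f, label i) :: ξ' ∧ (child i).IsPath ξ' d := by
  constructor
  · rintro ⟨⟩
    exact ⟨_, _, rfl, ‹_›⟩
  · rintro ⟨i, ξ', rfl, h⟩
    exact .working _ _ _ _ _ _ _ h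

theorem paths_terminal (d : ℕ+) : (terminal d : TreeNode α).paths = {([], d)} := by
  ext ⟨ξ, d'⟩
  simp [paths, isPath_terminal_iff]

theorem paths_working (f : α) (k : ℕ) (label : Fin (k + 1) → Bool)
    (child : Fin (k + 1) → TreeNode α) :
    (working f k label child).paths =
      ⋃ i, Prod.map (List.cons (f, label i)) id '' (child i).paths := by
  ext ⟨ξ, d⟩
  simp [paths, isPath_working_iff, eq_comm, and_comm]

theorem finite_paths (t : TreeNode α) : t.paths.Finite := by
  induction t with
  | terminal d => simp [paths_terminal]
  | working f k label child ih =>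
    rw [paths_working]
    exact Set.finite_iUnion fun i => (ih i).image _

theorem depth_child_lt (f : α) {k : ℕ} (label : Fin (k + 1) → Bool)
    (child : Fin (k + 1) → TreeNode α) (i : Fin (k + 1)) :
    (child i).depth < (working f k label child).depth := by
  have := Finset.le_sup (f := fun i => (child i).depth) (Finset.mem_univ i)
  simp only [depth]
  omega

theorem IsPath.length_le_depth {t : TreeNode α} {ξ : List (α × Bool)} {d : ℕ+}
    (h : t.IsPath ξ d) : ξ.length ≤ t.depth := by
  induction h with
  | terminal => simp
  | working f k label child i _ _ _ ih => exact ih.trans_lt (depth_child_lt f label child i)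

theorem Deterministic.encard_paths_le {t : TreeNode α} (h : t.Deterministic) :
    t.paths.encard ≤ ((2 ^ t.depth : ℕ) : ℕ∞) := by
  induction t with
  | terminal d => simp [paths_terminal, depth]
  | working f k label child ih =>
    obtain ⟨label_inj, child_det⟩ := h
    have edges_le : k + 1 ≤ 2 := by simpa using Fintype.card_le_of_injective label label_inj
    obtain ⟨s, hs⟩ : ∃ s, (working f k label child).depth = 1 + s := ⟨_, rfl⟩
    rw [paths_working, hs]
    calc (⋃ i, Prod.map (List.cons (f, label i)) id '' (child i).paths).encard
        ≤ ∑ i, (Prod.map (List.cons (f, label i)) id '' (child i).paths).encard :=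
          Set.encard_iUnion_le_of_fintype _
      _ ≤ ∑ _i : Fin (k + 1), ((2 ^ s : ℕ) : ℕ∞) := by
          refine Finset.sum_le_sum fun i _ =>
            (Set.encard_image_le _ _).trans ((ih i (child_det i)).trans ?_)
          have := depth_child_lt f label child i
          exact_mod_cast Nat.pow_le_pow_right two_pos (by omega)
      _ ≤ ((2 ^ (1 + s) : ℕ) : ℕ∞) := by
          rw [Finset.sum_const, Finset.card_univ, Fintype.card_fin, nsmul_eq_mul, pow_add, pow_one]
          exact_mod_cast Nat.mul_le_mul_right _ edges_le

/-- Some path of `t` compatible with `δ` ends in a terminal node labelled `d`. -/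
def Accepts (t : TreeNode α) (δ : α → Bool) (d : ℕ+) : Prop := ∃ ξ, t.IsPath ξ d ∧ Satisfies δ ξ

@[simp]
theorem accepts_terminal {δ : α → Bool} {d d' : ℕ+} : (terminal d).Accepts δ d' ↔ d' = d := by
  simp [Accepts, isPath_terminal_iff]

theorem accepts_working {f : α} {k : ℕ} {label : Fin (k + 1) → Bool}
    {child : Fin (k + 1) → TreeNode α} {δ : α → Bool} {d : ℕ+} :
    (working f k label child).Accepts δ d ↔ ∃ i, δ f = label i ∧ (child i).Accepts δ d := by
  simp only [Accepts, isPath_working_iff]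
  constructor
  · rintro ⟨_, ⟨i, ξ, rfl, path⟩, sat⟩
    rw [satisfies_cons] at sat
    exact ⟨i, sat.1, ξ, path, sat.2⟩
  · rintro ⟨i, hi, ξ, path, sat⟩
    exact ⟨_, ⟨i, ξ, rfl, path⟩, satisfies_cons.2 ⟨hi, sat⟩⟩

/-- The tree whose root is a working node labelled `f` with two leaving edges; the edge labelled
`x` enters the root of `t x`. -/
def branch (f : α) (t : Bool → TreeNode α) : TreeNode α :=
  working f 1 finTwoEquiv fun i => t (finTwoEquiv i)

theorem depth_branch_le (f : α) {t : Bool → TreeNode α} {h : ℕ} (ht : ∀ x, (t x).depth ≤ h) :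
    (branch f t).depth ≤ h + 1 := by
  rw [branch, depth, add_comm]
  exact Nat.add_le_add_right (Finset.sup_le fun i _ => ht _) 1

theorem size_branch (f : α) (t : Bool → TreeNode α) :
    (branch f t).size = (t true).size + (t false).size + 1 := by
  rw [branch, size, Equiv.sum_comp finTwoEquiv fun x => (t x).size, Fintype.sum_bool, add_comm]

theorem accepts_branch {f : α} {t : Bool → TreeNode α} {δ : α → Bool} {d : ℕ+} :
    (branch f t).Accepts δ d ↔ (t (δ f)).Accepts δ d := by
  refine accepts_working.trans ((finTwoEquiv.surjective.exists
    (p := fun x => δ f = x ∧ (t x).Accepts δ d)).symm.trans ?_)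
  simp

/-- `t` is deterministic and computes the function `v` on the class `D` of Boolean functions. -/
def Computes (t : TreeNode α) (D : Set (α → Bool)) (v : (α → Bool) → ℕ+) : Prop :=
  t.Deterministic ∧ ∀ δ ∈ D, ∀ d, t.Accepts δ d ↔ d = v δ

variable {D D' : Set (α → Bool)} {v : (α → Bool) → ℕ+}

theorem Computes.mono {t : TreeNode α} (ht : t.Computes D v) (h : D' ⊆ D) : t.Computes D' v :=
  ⟨ht.1, fun δ hδ => ht.2 δ (h hδ)⟩

theorem Computes.branch {f : α} {t : Bool → TreeNode α}
    (ht : ∀ x, (t x).Computes {δ ∈ D | δ f = x} v) : (branch f t).Computes D v :=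
  ⟨⟨finTwoEquiv.injective, fun _ => (ht _).1⟩,
    fun δ hδ d => accepts_branch.trans ((ht (δ f)).2 δ ⟨hδ, rfl⟩ d)⟩

theorem exists_computes_terminal (hv : ∀ δ ∈ D, ∀ δ' ∈ D, v δ = v δ') :
    ∃ d, (terminal d).Computes D v := by
  rcases D.eq_empty_or_nonempty with rfl | ⟨δ₀, hδ₀⟩
  · exact ⟨1, trivial, by simp⟩
  · exact ⟨v δ₀, trivial, fun δ hδ d => by rw [accepts_terminal, hv δ hδ δ₀ hδ₀]⟩

end TreeNode

namespace DecisionTree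

variable {α : Type u}

/-- The set of complete paths of `Γ`, with the labels of their terminal nodes. -/
def paths (Γ : DecisionTree α) : Set (List (α × Bool) × ℕ+) := {p | Γ.IsPath p.1 p.2}

theorem paths_eq_iUnion (Γ : DecisionTree α) : Γ.paths = ⋃ i, (Γ.child i).paths := by
  ext p
  simp [paths, IsPath, TreeNode.paths]

theorem finite_paths (Γ : DecisionTree α) : Γ.paths.Finite := by
  rw [paths_eq_iUnion]
  exact Set.finite_iUnion fun i => (Γ.child i).finite_paths

theorem depth_child_le (Γ : DecisionTree α) (i : Fin (Γ.k + 1)) : (Γ.child i).depth ≤ Γ.depth :=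
  Finset.le_sup (f := fun i => (Γ.child i).depth) (Finset.mem_univ i)

theorem IsPath.length_le_depth {Γ : DecisionTree α} {ξ : List (α × Bool)} {d : ℕ+}
    (h : Γ.IsPath ξ d) : ξ.length ≤ Γ.depth :=
  h.elim fun i hi => hi.length_le_depth.trans (Γ.depth_child_le i)

theorem Deterministic.encard_paths_le {Γ : DecisionTree α} (h : Γ.Deterministic) :
    Γ.paths.encard ≤ ((2 ^ Γ.depth : ℕ) : ℕ∞) := by
  have : Γ.paths = (Γ.child 0).paths := by
    have eq_zero : ∀ i : Fin (Γ.k + 1), i = 0 := fun i => Fin.ext (by have := h.1; omega)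
    rw [paths_eq_iUnion]
    exact (Set.iUnion_congr fun i => by rw [eq_zero i]).trans (Set.iUnion_const _)
  rw [this]
  refine (h.2 0).encard_paths_le.trans ?_
  exact_mod_cast Nat.pow_le_pow_right two_pos (Γ.depth_child_le 0)

end DecisionTree

section Patterns

variable {α : Type u} {D D' : Set (α → Bool)} {X Y : Finset α} {δ δ' : α → Bool}

/-- The pattern of `δ` on `X`: the restriction of `δ` to `X`, encoded as the set of those `f ∈ X`
with `δ f = 1`. -/
def pattern (X : Finset α) (δ : α → Bool) : Finset α := {f ∈ X | δ f = true}

open scoped Classical in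
/-- The set of patterns on `X` of the members of `D`. -/
noncomputable def patterns (X : Finset α) (D : Set (α → Bool)) : Finset (Finset α) :=
  {S ∈ X.powerset | ∃ δ ∈ D, pattern X δ = S}

theorem mem_patterns {S : Finset α} : S ∈ patterns X D ↔ ∃ δ ∈ D, pattern X δ = S := by
  classical
  rw [patterns, Finset.mem_filter, Finset.mem_powerset, and_iff_right_iff_imp]
  rintro ⟨δ, -, rfl⟩
  exact Finset.filter_subset _ _

theorem subset_of_mem_patterns {S : Finset α} (hS : S ∈ patterns X D) : S ⊆ X :=
  let ⟨_, _, hS⟩ := mem_patterns.1 hS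
  hS ▸ Finset.filter_subset _ _

theorem pattern_eq_pattern_iff : pattern X δ = pattern X δ' ↔ Set.EqOn δ δ' X := by
  simp only [pattern, Finset.filter_inj', Bool.coe_iff_coe]
  rfl

theorem eqOn_insert [DecidableEq α] {f : α} :
    Set.EqOn δ δ' ↑(insert f X) ↔ δ f = δ' f ∧ Set.EqOn δ δ' X := by
  simp [Set.EqOn]

theorem patterns_nonempty (hD : D.Nonempty) : (patterns X D).Nonempty :=
  hD.elim fun _ hδ => ⟨_, mem_patterns.2 ⟨_, hδ, rfl⟩⟩

theorem patterns_mono (h : D ⊆ D') : patterns X D ⊆ patterns X D' := fun _ hS =>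
  let ⟨δ, hδ, hS⟩ := mem_patterns.1 hS
  mem_patterns.2 ⟨δ, h hδ, hS⟩

theorem card_patterns_le_two_pow (X : Finset α) (D : Set (α → Bool)) :
    (patterns X D).card ≤ 2 ^ X.card := by
  rw [← Finset.card_powerset]
  exact Finset.card_le_card fun _ hS => Finset.mem_powerset.2 (subset_of_mem_patterns hS)

theorem card_patterns_le_of_eqOn
    (h : ∀ δ ∈ D, ∀ δ' ∈ D, Set.EqOn δ δ' Y → Set.EqOn δ δ' X) :
    (patterns X D).card ≤ (patterns Y D).card := by
  have : ∀ S ∈ patterns X D, ∃ δ ∈ D, pattern X δ = S := fun S => mem_patterns.1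
  choose! δ mem_D pattern_δ using this
  refine Finset.card_le_card_of_injOn (fun S => pattern Y (δ S))
    (fun S hS => mem_patterns.2 ⟨_, mem_D S hS, rfl⟩) fun S hS T hT hST => ?_
  rw [← pattern_δ S hS, ← pattern_δ T hT, pattern_eq_pattern_iff]
  exact h _ (mem_D S hS) _ (mem_D T hT) (pattern_eq_pattern_iff.1 hST)

theorem ncard_image_eq_card_patterns {β : Type*} {v : (α → Bool) → β}
    (hv : ∀ δ ∈ D, ∀ δ' ∈ D, v δ = v δ' ↔ Set.EqOn δ δ' X) :
    (v '' D).ncard = (patterns X D).card := by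
  have : ∀ S ∈ patterns X D, ∃ δ ∈ D, pattern X δ = S := fun S => mem_patterns.1
  choose! δ mem_D pattern_δ using this
  have image_eq : v '' D = (fun S => v (δ S)) '' (patterns X D : Set (Finset α)) := by
    refine Set.Subset.antisymm ?_ (Set.image_subset_iff.2 fun S hS => ⟨_, mem_D S hS, rfl⟩)
    rintro _ ⟨δ', hδ', rfl⟩
    have hS : pattern X δ' ∈ patterns X D := mem_patterns.2 ⟨δ', hδ', rfl⟩
    exact ⟨_, hS, (hv _ (mem_D _ hS) _ hδ').2 (pattern_eq_pattern_iff.1 (pattern_δ _ hS))⟩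
  rw [image_eq, Set.InjOn.ncard_image, Set.ncard_coe_finset]
  intro S hS T hT hST
  rw [← pattern_δ S hS, ← pattern_δ T hT, pattern_eq_pattern_iff]
  exact (hv _ (mem_D S hS) _ (mem_D T hT)).1 hST

theorem card_patterns_mono (h : X ⊆ Y) : (patterns X D).card ≤ (patterns Y D).card :=
  card_patterns_le_of_eqOn fun _ _ _ _ hδ => hδ.mono (Finset.coe_subset.2 h)

theorem card_patterns_eq_sum {g : α} (hg : g ∈ X) :
    (patterns X D).card = ∑ x, (patterns X {δ ∈ D | δ g = x}).card := by
  classical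
  have part (x : Bool) :
      patterns X {δ ∈ D | δ g = x} = (patterns X D).filter fun S => g ∈ S ↔ x = true := by
    ext S
    simp only [mem_patterns, Finset.mem_filter, Set.mem_ofPred_eq]
    constructor
    · rintro ⟨δ, ⟨hδ, rfl⟩, rfl⟩
      exact ⟨⟨δ, hδ, rfl⟩, by simp [pattern, hg]⟩
    · rintro ⟨⟨δ, hδ, rfl⟩, hx⟩
      exact ⟨δ, ⟨hδ, by simpa [pattern, hg] using hx⟩, rfl⟩
  simp only [Fintype.sum_bool, part, iff_true, Bool.false_eq_true, iff_false]
  exact (Finset.card_filter_add_card_filter_not _).symm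

theorem card_patterns_insert [DecidableEq α] (f : α) (X : Finset α) (D : Set (α → Bool)) :
    (patterns (insert f X) D).card = ∑ x, (patterns X {δ ∈ D | δ f = x}).card := by
  rw [card_patterns_eq_sum (Finset.mem_insert_self f X)]
  refine Finset.sum_congr rfl fun x _ =>
    (card_patterns_le_of_eqOn fun δ hδ δ' hδ' h => ?_).antisymm
      (card_patterns_mono (Finset.subset_insert f X))
  exact eqOn_insert.2 ⟨hδ.2.trans hδ'.2.symm, h⟩

theorem card_patterns_biUnion_le {ι : Type*} (s : Finset ι) (D : ι → Set (α → Bool)) :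
    (patterns X (⋃ i ∈ s, D i)).card ≤ ∑ i ∈ s, (patterns X (D i)).card := by
  classical
  refine (Finset.card_le_card fun S hS => ?_).trans Finset.card_biUnion_le
  obtain ⟨δ, hδ, hS⟩ := mem_patterns.1 hS
  obtain ⟨i, hi, hδ⟩ := Set.mem_iUnion₂.1 hδ
  exact Finset.mem_biUnion.2 ⟨i, hi, mem_patterns.2 ⟨δ, hδ, hS⟩⟩

/-- Every Boolean function agrees on `X` with a member of `D`; with the Vapnik–Chervonenkis
terminology, `D` shatters `X`. -/
def ShattersOn (D : Set (α → Bool)) (X : Finset α) : Prop := ∀ δ, ∃ δ' ∈ D, Set.EqOn δ' δ X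

theorem ShattersOn.mono (h : ShattersOn D Y) (hX : X ⊆ Y) : ShattersOn D X := fun δ =>
  (h δ).imp fun _ hδ' => ⟨hδ'.1, hδ'.2.mono (Finset.coe_subset.2 hX)⟩

theorem ShattersOn.patterns_eq (h : ShattersOn D X) : patterns X D = X.powerset := by
  classical
  refine Finset.Subset.antisymm (fun _ hS =>
    Finset.mem_powerset.2 (subset_of_mem_patterns hS)) fun S hS => mem_patterns.2 ?_
  obtain ⟨δ, hδ, eq⟩ := h fun f => decide (f ∈ S)
  refine ⟨δ, hδ, (pattern_eq_pattern_iff.2 eq).trans ?_⟩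
  simp [pattern, Finset.mem_powerset.1 hS]

theorem shattersOn_of_shatters [DecidableEq α] {Z : Finset α} (h : (patterns X D).Shatters Z) :
    Z ⊆ X ∧ ShattersOn D Z := by
  obtain ⟨S, hS, hZ⟩ := h.exists_superset
  refine ⟨hZ.trans (subset_of_mem_patterns hS), fun δ => ?_⟩
  obtain ⟨T, hT, inter_eq⟩ := h (Finset.filter_subset (δ · = true) Z)
  obtain ⟨δ', hδ', rfl⟩ := mem_patterns.1 hT
  refine ⟨δ', hδ', pattern_eq_pattern_iff.1 (Eq.trans ?_ inter_eq)⟩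
  rw [pattern, pattern, Finset.inter_filter,
    Finset.inter_eq_left.2 (hZ.trans (subset_of_mem_patterns hS))]

theorem sum_choose_le_pow (n d : ℕ) : ∑ i ∈ Finset.range (d + 1), n.choose i ≤ (n + 1) ^ d := by
  rw [add_pow]
  refine Finset.sum_le_sum fun i hi => ?_
  rw [one_pow, mul_one]
  exact (Nat.choose_le_pow n i).trans
    (Nat.le_mul_of_pos_right _ (Nat.choose_pos (Nat.lt_succ_iff.1 (Finset.mem_range.1 hi))))

/-- The Sauer–Shelah bound. -/
theorem card_patterns_le_pow {d : ℕ} (hd : ∀ Z ⊆ X, ShattersOn D Z → Z.card ≤ d) :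
    (patterns X D).card ≤ (X.card + 1) ^ d := by
  classical
  have shatterer_subset :
      (patterns X D).shatterer ⊆ (Finset.range (d + 1)).biUnion fun i => X.powersetCard i := by
    intro Z hZ
    obtain ⟨hZX, hZ⟩ := shattersOn_of_shatters (Finset.mem_shatterer.1 hZ)
    simp [hZX, hd Z hZX hZ]
  calc (patterns X D).card
      ≤ (patterns X D).shatterer.card := Finset.card_le_card_shatterer _
    _ ≤ ∑ i ∈ Finset.range (d + 1), (X.powersetCard i).card :=
        (Finset.card_le_card shatterer_subset).trans Finset.card_biUnion_le
    _ ≤ (X.card + 1) ^ d := by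
        simpa only [Finset.card_powersetCard] using sum_choose_le_pow X.card d

/-- On the class `D`, the function `v` depends only on the values at the elements of `X`. -/
def DeterminedBy {β : Type*} (D : Set (α → Bool)) (X : Finset α) (v : (α → Bool) → β) : Prop :=
  ∀ δ ∈ D, ∀ δ' ∈ D, Set.EqOn δ δ' X → v δ = v δ'

theorem card_patterns_lt_card_patterns_insert [DecidableEq α] {g : α}
    (hg : ¬ DeterminedBy D X fun δ => δ g) :
    (patterns X D).card < (patterns (insert g X) D).card := by
  unfold DeterminedBy at hg
  push Not at hg
  obtain ⟨δ, hδ, δ', hδ', eqOn, ne⟩ := hg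
  let P (x : Bool) := patterns X {δ ∈ D | δ g = x}
  have common (x : Bool) : pattern X δ ∈ P x := by
    by_cases hx : δ g = x
    · exact mem_patterns.2 ⟨δ, ⟨hδ, hx⟩, rfl⟩
    · have hx' : δ' g = x :=
        (Bool.eq_not.2 (Ne.symm ne)).trans (Bool.eq_not.2 (Ne.symm hx)).symm
      exact mem_patterns.2 ⟨δ', ⟨hδ', hx'⟩, (pattern_eq_pattern_iff.2 eqOn).symm⟩
  have subset : patterns X D ⊆ P true ∪ P false := fun S hS => by
    obtain ⟨δ, hδ, rfl⟩ := mem_patterns.1 hS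
    rw [Finset.mem_union]
    cases h : δ g
    · exact .inr (mem_patterns.2 ⟨δ, ⟨hδ, h⟩, rfl⟩)
    · exact .inl (mem_patterns.2 ⟨δ, ⟨hδ, h⟩, rfl⟩)
  have inter_pos : 0 < (P true ∩ P false).card :=
    Finset.card_pos.2 ⟨_, Finset.mem_inter.2 ⟨common true, common false⟩⟩
  have := Finset.card_le_card subset
  have := Finset.card_union_add_card_inter (P true) (P false)
  rw [card_patterns_insert, Fintype.sum_bool]
  change _ < (P true).card + (P false).card
  omega

end Patterns

namespace TreeNode

variable {α : Type u} {D : Set (α → Bool)}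

/-- Query the elements of `X` one by one, skipping those whose value is already known. -/
theorem exists_computes {v : (α → Bool) → ℕ+} {X : Finset α} (hD : D.Nonempty)
    (hv : DeterminedBy D X v) :
    ∃ t : TreeNode α, t.Computes D v ∧ t.depth ≤ X.card ∧ t.size + 1 ≤ 2 * (patterns X D).card := by
  classical
  induction X using Finset.induction_on generalizing D with
  | empty =>
    obtain ⟨d, hd⟩ := exists_computes_terminal (D := D) (v := v) fun δ hδ δ' hδ' =>
      hv δ hδ δ' hδ' (by simp)
    have := (patterns_nonempty (X := ∅) hD).card_pos
    exact ⟨_, hd, le_rfl, by rw [size]; omega⟩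
  | insert f X hf ih =>
    have ih_part (x : Bool) (hx : {δ ∈ D | δ f = x}.Nonempty) := ih hx fun δ hδ δ' hδ' h =>
      hv δ hδ.1 δ' hδ'.1 (eqOn_insert.2 ⟨hδ.2.trans hδ'.2.symm, h⟩)
    rw [card_patterns_insert, Fintype.sum_bool, Finset.card_insert_of_notMem hf]
    by_cases h : ∃ x, ¬ {δ ∈ D | δ f = x}.Nonempty
    · obtain ⟨x, hx⟩ := h
      have eq_D : {δ ∈ D | δ f = !x} = D := Set.sep_eq_self_iff_mem_true.2 fun δ hδ =>
        Bool.eq_not.2 fun h => hx ⟨δ, hδ, h⟩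
      obtain ⟨t, computes, depth_le, size_le⟩ := ih_part (!x) (by rwa [eq_D])
      refine ⟨t, by rwa [eq_D] at computes, by omega, ?_⟩
      cases x <;> simp only [Bool.not_true, Bool.not_false] at size_le <;> omega
    · push Not at h
      choose t computes depth_le size_le using fun x => ih_part x (h x)
      refine ⟨branch f t, .branch computes, depth_branch_le f depth_le, ?_⟩
      have := size_le true
      have := size_le false
      rw [size_branch]
      omega

end TreeNode

/-! ### Number of nodes -/

section NodeCount

variable {β : Type*} {V V' W W' : Set β} {m n : ℕ}

/-- Half of `n` bounds the number of elements of `W ⊆ V`, up to rounding: rounding up is only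
allowed when `W` exhausts `V`. This is the invariant of the induction that bounds from below the
number of nodes of a tree with the set `W` of attained values, among the set `V` of all possible
ones. -/
structure HalfBounded (V W : Set β) (n : ℕ) : Prop where
  subset : W ⊆ V
  two_mul_ncard_le : 2 * W.ncard ≤ n + 1
  two_mul_ncard_le_of_ne : W ≠ V → 2 * W.ncard ≤ n

theorem HalfBounded.biUnion {ι : Type*} {s : Finset ι} {W : ι → Set β} {n : ι → ℕ}
    (h : ∀ i ∈ s, HalfBounded V (W i) (n i)) : HalfBounded V (⋃ i ∈ s, W i) (∑ i ∈ s, n i) := by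
  have subset : (⋃ i ∈ s, W i) ⊆ V := Set.iUnion₂_subset fun i hi => (h i hi).subset
  by_cases exhausted : ∃ i ∈ s, W i = V
  · obtain ⟨i, hi, rfl⟩ := exhausted
    have eq : (⋃ j ∈ s, W j) = W i := subset.antisymm (Set.subset_biUnion_of_mem (u := W) hi)
    rw [eq]
    refine ⟨subset_rfl, (h i hi).two_mul_ncard_le.trans ?_, fun hne => absurd rfl hne⟩
    exact Nat.add_le_add_right (Finset.single_le_sum (f := n) (fun _ _ => Nat.zero_le _) hi) 1
  · push Not at exhausted
    have le : 2 * (⋃ i ∈ s, W i).ncard ≤ ∑ i ∈ s, n i := calc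
      2 * (⋃ i ∈ s, W i).ncard ≤ 2 * ∑ i ∈ s, (W i).ncard :=
        Nat.mul_le_mul_left 2 (Finset.set_ncard_biUnion_le s W)
      _ = ∑ i ∈ s, 2 * (W i).ncard := Finset.mul_sum ..
      _ ≤ ∑ i ∈ s, n i :=
        Finset.sum_le_sum fun i hi => (h i hi).two_mul_ncard_le_of_ne (exhausted i hi)
    exact ⟨subset, le.trans (Nat.le_succ _), fun _ => le⟩

theorem HalfBounded.union (h : HalfBounded V W m) (h' : HalfBounded V' W' n) :
    HalfBounded (V ∪ V') (W ∪ W') (1 + (m + n)) := by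
  have card_union := Set.ncard_union_le W W'
  have le := h.two_mul_ncard_le
  have le' := h'.two_mul_ncard_le
  refine ⟨Set.union_subset_union h.subset h'.subset, by omega, fun hne => ?_⟩
  by_cases hW : W = V
  · have := h'.two_mul_ncard_le_of_ne fun hW' => hne (by rw [hW, hW'])
    omega
  · have := h.two_mul_ncard_le_of_ne hW
    omega

end NodeCount

namespace TreeNode

variable {α : Type u}

/-- The labels of terminal nodes of `t` reached by members of `B`. -/
def acceptedValues (t : TreeNode α) (B : Set (α → Bool)) : Set ℕ+ := {d | ∃ δ ∈ B, t.Accepts δ d}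

theorem acceptedValues_working (f : α) (k : ℕ) (label : Fin (k + 1) → Bool)
    (child : Fin (k + 1) → TreeNode α) (B : Set (α → Bool)) :
    (working f k label child).acceptedValues B =
      (⋃ i ∈ Finset.univ.filter (label · = true), (child i).acceptedValues {δ ∈ B | δ f = true}) ∪
        ⋃ i ∈ Finset.univ.filter (¬ label · = true),
          (child i).acceptedValues {δ ∈ B | δ f = false} := by
  ext d
  simp only [acceptedValues, accepts_working, Finset.mem_filter, Finset.mem_univ, true_and,
    Set.mem_union, Set.mem_iUnion, Set.mem_ofPred_eq, exists_prop, Bool.not_eq_true]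
  constructor
  · rintro ⟨δ, hδ, i, hi, h⟩
    cases hx : label i
    · exact .inr ⟨i, hx, δ, ⟨hδ, hi.trans hx⟩, h⟩
    · exact .inl ⟨i, hx, δ, ⟨hδ, hi.trans hx⟩, h⟩
  · rintro (⟨i, hx, δ, ⟨hδ, hi⟩, h⟩ | ⟨i, hx, δ, ⟨hδ, hi⟩, h⟩)
    all_goals exact ⟨δ, hδ, i, hi.trans hx.symm, h⟩

theorem halfBounded_acceptedValues {t : TreeNode α} {B : Set (α → Bool)} {v : (α → Bool) → ℕ+}
    (sound : ∀ δ ∈ B, ∀ d, t.Accepts δ d → d = v δ) :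
    HalfBounded (v '' B) (t.acceptedValues B) t.size := by
  induction t generalizing B with
  | terminal d =>
    have eq : (terminal d).acceptedValues B = v '' B := by
      ext d'
      simp only [acceptedValues, accepts_terminal, Set.mem_ofPred_eq, Set.mem_image]
      refine exists_congr fun δ => and_congr_right fun hδ => ?_
      rw [← sound δ hδ d (accepts_terminal.2 rfl), eq_comm]
    have subset : (terminal d).acceptedValues B ⊆ {d} := fun d' ⟨_, _, h⟩ => accepts_terminal.1 h
    have := Set.ncard_le_ncard subset
    rw [Set.ncard_singleton] at this
    exact ⟨eq.subset, by rw [size]; omega, fun hne => absurd eq hne⟩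
  | working f k label child ih =>
    have ih_part (x : Bool) (i) (hi : label i = x) :
        HalfBounded (v '' {δ ∈ B | δ f = x}) ((child i).acceptedValues {δ ∈ B | δ f = x})
          (child i).size :=
      ih i fun δ hδ d h => sound δ hδ.1 d (accepts_working.2 ⟨i, hδ.2.trans hi.symm, h⟩)
    have image_eq : v '' B = v '' {δ ∈ B | δ f = true} ∪ v '' {δ ∈ B | δ f = false} := by
      rw [← Set.image_union]
      congr 1
      ext δ
      cases h : δ f <;> simp [h]
    rw [acceptedValues_working, image_eq, size,
      ← Finset.sum_filter_add_sum_filter_not Finset.univ (label · = true)]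
    refine .union (.biUnion fun i hi => ?_) (.biUnion fun i hi => ?_)
    · exact ih_part true i (Finset.mem_filter.1 hi).2
    · exact ih_part false i (Bool.not_eq_true _ ▸ (Finset.mem_filter.1 hi).2)

end TreeNode

namespace InfoSystem

variable {U : InfoSystem.{u}}

/-- The object `a` as a Boolean function on the attributes of `U`. -/
def profile (a : U.A) : U.F → Bool := fun f => f.1 a

/-- The class of Boolean functions on the attributes of `U` that are given by objects. -/
def profiles (U : InfoSystem.{u}) : Set (U.F → Bool) := Set.range U.profile

theorem profiles_nonempty (U : InfoSystem.{u}) : U.profiles.Nonempty :=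
  have := U.infinite_A
  Set.range_nonempty _

theorem solvesNondet_iff {Γ : U.Tree} {z : U.Problem} :
    SolvesNondet Γ z ↔ (∀ a, ∃ i, (Γ.child i).Accepts (profile a) (z.value a)) ∧
      ∀ a i d, (Γ.child i).Accepts (profile a) d → d = z.value a := by
  constructor
  · rintro ⟨covers, sound⟩
    refine ⟨fun a => ?_, fun a i d ⟨ξ, path, sat⟩ => sound a ξ d ⟨i, path⟩ sat⟩
    obtain ⟨ξ, d, ⟨i, path⟩, sat⟩ := covers a
    obtain rfl := sound a ξ d ⟨i, path⟩ sat
    exact ⟨i, ξ, path, sat⟩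
  · rintro ⟨covers, sound⟩
    refine ⟨fun a => ?_, fun a ξ d ⟨i, path⟩ sat => sound a i d ⟨ξ, path, sat⟩⟩
    obtain ⟨i, ξ, path, sat⟩ := covers a
    exact ⟨ξ, _, ⟨i, path⟩, sat⟩

namespace Problem

variable (z : U.Problem)

/-- The function `z` extended from objects to all Boolean functions on the attributes of `U`. -/
def valueAt (δ : U.F → Bool) : ℕ+ := z.ν fun i => δ (z.f i)

open scoped Classical in
/-- The set of attributes of `z`. -/
noncomputable def attrs : Finset U.F := Finset.univ.image z.f

theorem card_attrs_le : z.attrs.card ≤ z.dim := by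
  classical
  exact Finset.card_image_le.trans_eq (Finset.card_fin _)

theorem eqOn_attrs_iff {δ δ' : U.F → Bool} :
    Set.EqOn δ δ' z.attrs ↔ (fun i => δ (z.f i)) = fun i => δ' (z.f i) := by
  simp [attrs, Set.eqOn_range, funext_iff]

theorem determinedBy_attrs (D : Set (U.F → Bool)) : DeterminedBy D z.attrs z.valueAt :=
  fun _ _ _ _ h => congrArg z.ν (z.eqOn_attrs_iff.1 h)

theorem range_value : Set.range z.value = z.valueAt '' U.profiles :=
  Set.range_comp z.valueAt profile

theorem ncard_range_value (hν : Function.Injective z.ν) :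
    (Set.range z.value).ncard = (patterns z.attrs U.profiles).card := by
  rw [range_value]
  exact ncard_image_eq_card_patterns fun δ _ δ' _ => hν.eq_iff.trans z.eqOn_attrs_iff.symm

variable {z}

theorem solvesDet_of_computes {t : TreeNode U.F} (ht : t.Computes U.profiles z.valueAt) :
    SolvesDet ⟨0, fun _ => t⟩ z :=
  ⟨⟨rfl, fun _ => ht.1⟩, solvesNondet_iff.2
    ⟨fun a => ⟨0, (ht.2 _ ⟨a, rfl⟩ _).2 rfl⟩, fun a _ d => (ht.2 _ ⟨a, rfl⟩ d).1⟩⟩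

theorem hd_le_depth {t : TreeNode U.F} (ht : t.Computes U.profiles z.valueAt) : z.hd ≤ t.depth := by
  refine (iInf₂_le (_ : U.Tree) (solvesDet_of_computes ht)).trans ?_
  simp [DecisionTree.depth]

theorem Ld_le_size {t : TreeNode U.F} (ht : t.Computes U.profiles z.valueAt) :
    z.Ld ≤ ((t.size + 1 : ℕ) : ℕ∞) := by
  refine (iInf₂_le (_ : U.Tree) (solvesDet_of_computes ht)).trans ?_
  simp [DecisionTree.size, add_comm]

variable (z)

theorem hd_le_dim : z.hd ≤ z.dim := by
  obtain ⟨t, computes, depth_le, -⟩ :=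
    TreeNode.exists_computes U.profiles_nonempty (z.determinedBy_attrs _)
  exact (hd_le_depth computes).trans (by exact_mod_cast depth_le.trans z.card_attrs_le)

theorem Ld_le : z.Ld ≤ ((2 * (patterns z.attrs U.profiles).card : ℕ) : ℕ∞) := by
  obtain ⟨t, computes, -, size_le⟩ :=
    TreeNode.exists_computes U.profiles_nonempty (z.determinedBy_attrs _)
  exact (Ld_le_size computes).trans (by exact_mod_cast size_le)

theorem ha_le_hd : z.ha ≤ z.hd := le_iInf₂ fun Γ h => iInf₂_le Γ h.2

theorem La_le_Ld : z.La ≤ z.Ld := le_iInf₂ fun Γ h => iInf₂_le Γ h.2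

theorem two_mul_ncard_range_value_le_La :
    ((2 * (Set.range z.value).ncard : ℕ) : ℕ∞) ≤ z.La := by
  refine le_iInf₂ fun Γ hΓ => ?_
  obtain ⟨covers, sound⟩ := solvesNondet_iff.1 hΓ
  have union_eq : (⋃ i ∈ Finset.univ, (Γ.child i).acceptedValues U.profiles) =
      Set.range z.value := by
    ext d
    simp only [Finset.mem_univ, Set.iUnion_true, Set.mem_iUnion, TreeNode.acceptedValues]
    constructor
    · rintro ⟨i, _, ⟨a, rfl⟩, h⟩
      exact ⟨a, (sound a i d h).symm⟩
    · rintro ⟨a, rfl⟩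
      exact (covers a).imp fun i h => ⟨_, ⟨a, rfl⟩, h⟩
  have bounded : HalfBounded _ (⋃ i ∈ Finset.univ, (Γ.child i).acceptedValues U.profiles)
      (∑ i, (Γ.child i).size) := .biUnion fun i _ =>
    TreeNode.halfBounded_acceptedValues (v := z.valueAt) (by
      rintro _ ⟨a, rfl⟩ d h
      exact sound a i d h)
  have := bounded.two_mul_ncard_le
  rw [union_eq] at this
  exact_mod_cast this.trans_eq (add_comm _ _)

theorem finite_range_value : (Set.range z.value).Finite :=
  (Set.finite_range z.ν).subset (Set.range_comp_subset_range _ z.ν)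

theorem ncard_range_value_le_two_pow {Γ : U.Tree} (h : SolvesDet Γ z) :
    (Set.range z.value).ncard ≤ 2 ^ Γ.depth := by
  have subset : Set.range z.value ⊆ Prod.snd '' Γ.paths := by
    rintro _ ⟨a, rfl⟩
    obtain ⟨ξ, d, path, sat⟩ := h.2.1 a
    exact ⟨(ξ, d), path, h.2.2 a ξ d path sat⟩
  have := (Set.encard_le_encard subset).trans ((Set.encard_image_le _ _).trans h.1.encard_paths_le)
  rw [← z.finite_range_value.cast_ncard_eq] at this
  exact_mod_cast this

theorem le_hd {k : ℕ} (h : 2 ^ k < 2 * (Set.range z.value).ncard) : (k : ℕ∞) ≤ z.hd := by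
  refine le_iInf₂ fun Γ hΓ => ?_
  have : 2 ^ k < 2 ^ (Γ.depth + 1) := by
    have := z.ncard_range_value_le_two_pow hΓ
    rw [pow_succ]
    omega
  exact_mod_cast Nat.lt_succ_iff.1 ((Nat.pow_lt_pow_iff_right one_lt_two).1 this)

end Problem

end InfoSystem

namespace InfoSystem

variable {U : InfoSystem.{u}} {G : Finset U.F}

theorem hd_le (n : ℕ) : U.hd n ≤ n :=
  iSup₂_le fun z hz => z.hd_le_dim.trans (by exact_mod_cast hz)

theorem ha_le_hd (n : ℕ) : U.ha n ≤ U.hd n := iSup₂_mono fun z _ => z.ha_le_hd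

theorem La_le_Ld (n : ℕ) : U.La n ≤ U.Ld n := iSup₂_mono fun z _ => z.La_le_Ld

theorem Ld_le {n b : ℕ} (h : ∀ G : Finset U.F, G.card ≤ n → (patterns G U.profiles).card ≤ b) :
    U.Ld n ≤ ((2 * b : ℕ) : ℕ∞) :=
  iSup₂_le fun z hz => z.Ld_le.trans
    (by exact_mod_cast Nat.mul_le_mul_left 2 (h _ (z.card_attrs_le.trans hz)))

theorem Ld_le_two_pow (n : ℕ) : U.Ld n ≤ ((2 ^ (n + 1) : ℕ) : ℕ∞) := by
  rw [pow_succ']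
  exact Ld_le fun G hG =>
    (card_patterns_le_two_pow G _).trans (Nat.pow_le_pow_right two_pos hG)

/-- A problem with the set `G` of attributes whose value determines the pattern on `G`. -/
noncomputable def separatingProblem (G : Finset U.F) (hG : G.Nonempty) : U.Problem where
  dim := G.card
  dim_pos := hG.card_pos
  ν := fun x => (Fintype.equivFin (Fin G.card → Bool) x : ℕ).succPNat
  f := fun i => (G.equivFin.symm i).1

theorem attrs_separatingProblem (hG : G.Nonempty) : (separatingProblem G hG).attrs = G := by
  ext f
  simp only [Problem.attrs, Finset.mem_image]
  exact ⟨fun ⟨i, _, hi⟩ => hi ▸ (G.equivFin.symm i).2,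
    fun hf => ⟨G.equivFin ⟨f, hf⟩, Finset.mem_univ _, by simp [separatingProblem]⟩⟩

theorem ncard_range_value_separatingProblem (hG : G.Nonempty) :
    (Set.range (separatingProblem G hG).value).ncard = (patterns G U.profiles).card := by
  rw [Problem.ncard_range_value, attrs_separatingProblem]
  exact Nat.succPNat_injective.comp (Fin.val_injective.comp (Equiv.injective _))

theorem two_mul_card_patterns_le_La (hG : G.Nonempty) :
    ((2 * (patterns G U.profiles).card : ℕ) : ℕ∞) ≤ U.La G.card := by
  rw [← ncard_range_value_separatingProblem hG]
  exact (Problem.two_mul_ncard_range_value_le_La _).trans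
    (le_iSup₂_of_le (separatingProblem G hG) le_rfl le_rfl)

theorem le_hd {k : ℕ} (hG : G.Nonempty) (h : 2 ^ k < 2 * (patterns G U.profiles).card) :
    (k : ℕ∞) ≤ U.hd G.card := by
  rw [← ncard_range_value_separatingProblem hG] at h
  exact (Problem.le_hd _ h).trans (le_iSup₂_of_le (separatingProblem G hG) le_rfl le_rfl)

theorem exists_not_determinedBy (G : Finset U.F) :
    ∃ g : U.F, ¬ DeterminedBy U.profiles G (fun δ => δ g) := by
  by_contra! determined
  let Φ (g : U.F) : Set (patterns G U.profiles) :=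
    {S | ∃ a, pattern G (profile a) = S ∧ g.1 a = true}
  have mem_Φ (g : U.F) (a : U.A) :
      ⟨pattern G (profile a), mem_patterns.2 ⟨_, ⟨a, rfl⟩, rfl⟩⟩ ∈ Φ g ↔ g.1 a = true := by
    refine ⟨fun ⟨b, hab, hb⟩ => ?_, fun h => ⟨a, rfl, h⟩⟩
    exact (determined g _ ⟨a, rfl⟩ _ ⟨b, rfl⟩ (pattern_eq_pattern_iff.1 hab.symm)).trans hb
  have Φ_injective : Function.Injective Φ := fun g h hgh =>
    Subtype.ext (funext fun a => Bool.eq_iff_iff.2 ((mem_Φ g a).symm.trans (hgh ▸ mem_Φ h a)))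
  exact U.infinite_F (Set.finite_coe_iff.1 (Finite.of_injective Φ Φ_injective))

theorem exists_lt_card_patterns (U : InfoSystem.{u}) (n : ℕ) :
    ∃ G : Finset U.F, G.card = n ∧ n < (patterns G U.profiles).card := by
  classical
  induction n with
  | zero => exact ⟨∅, rfl, (patterns_nonempty U.profiles_nonempty).card_pos⟩
  | succ n ih =>
    obtain ⟨G, card_G, lt⟩ := ih
    obtain ⟨g, hg⟩ := exists_not_determinedBy G
    have notMem : g ∉ G := fun hgG => hg fun δ _ δ' _ h => h hgG
    refine ⟨insert g G, by rw [Finset.card_insert_of_notMem notMem, card_G], ?_⟩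
    have := card_patterns_lt_card_patterns_insert hg
    omega

theorem two_mul_succ_le_La (U : InfoSystem.{u}) {n : ℕ} (hn : 1 ≤ n) :
    ((2 * (n + 1) : ℕ) : ℕ∞) ≤ U.La n := by
  obtain ⟨G, rfl, lt⟩ := U.exists_lt_card_patterns n
  refine le_trans ?_ (two_mul_card_patterns_le_La (Finset.card_pos.1 hn))
  exact_mod_cast Nat.mul_le_mul_left 2 lt

theorem lt_two_pow_of_hd_le {n k : ℕ} (hn : 1 ≤ n) (h : U.hd n ≤ k) : n < 2 ^ k := by
  obtain ⟨G, rfl, lt⟩ := U.exists_lt_card_patterns n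
  by_contra! le
  have : ((k + 1 : ℕ) : ℕ∞) ≤ U.hd G.card :=
    le_hd (Finset.card_pos.1 hn) (by rw [pow_succ]; omega)
  have : k + 1 ≤ k := by exact_mod_cast this.trans h
  omega

theorem independent_map_iff :
    U.Independent (G.map (.subtype _)) ↔ ShattersOn U.profiles G := by
  classical
  constructor
  · intro h δ
    obtain ⟨a, ha⟩ := h fun f => if hf : f ∈ U.F then δ ⟨f, hf⟩ else false
    exact ⟨_, ⟨a, rfl⟩, fun f hf =>
      (ha f.1 (Finset.mem_map_of_mem (.subtype _) hf)).trans (dif_pos f.2)⟩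
  · intro h δ
    obtain ⟨_, ⟨a, rfl⟩, ha⟩ := h fun f => δ f.1
    refine ⟨a, fun f hf => ?_⟩
    obtain ⟨g, hg, rfl⟩ := Finset.mem_map.1 hf
    exact ha hg

theorem le_iDim_iff {n : ℕ} :
    (n : ℕ∞) ≤ U.iDim ↔ ∃ G : Finset U.F, G.card = n ∧ ShattersOn U.profiles G := by
  classical
  constructor
  · intro h
    rcases n with - | n
    · obtain ⟨δ, hδ⟩ := U.profiles_nonempty
      exact ⟨∅, rfl, fun _ => ⟨δ, hδ, by simp⟩⟩
    have lt : (n : ℕ∞) < U.iDim := lt_of_lt_of_le (by exact_mod_cast Nat.lt_succ_self n) h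
    simp only [iDim, lt_iSup_iff, Nat.cast_lt] at lt
    obtain ⟨S, ⟨hSF, hS⟩, lt⟩ := lt
    rw [← Finset.subtype_map_of_mem hSF, independent_map_iff] at hS
    rw [← Finset.subtype_map_of_mem hSF, Finset.card_map] at lt
    obtain ⟨G, hG, card_G⟩ := Finset.exists_subset_card_eq (Nat.succ_le_of_lt lt)
    exact ⟨G, card_G, hS.mono hG⟩
  · rintro ⟨G, rfl, hG⟩
    refine le_iSup₂_of_le (G.map (.subtype _)) ⟨fun f hf => ?_, independent_map_iff.2 hG⟩ ?_
    · obtain ⟨g, -, rfl⟩ := Finset.mem_map.1 hf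
      exact g.2
    · rw [Finset.card_map]

theorem card_le_of_shattersOn {d : ℕ} (hd : U.iDim ≤ d) (hG : ShattersOn U.profiles G) :
    G.card ≤ d := by
  exact_mod_cast (le_iDim_iff.2 ⟨G, rfl, hG⟩).trans hd

theorem card_patterns_profiles_le {d : ℕ} (hd : U.iDim ≤ d) (G : Finset U.F) :
    (patterns G U.profiles).card ≤ (G.card + 1) ^ d :=
  card_patterns_le_pow fun _ _ hZ => card_le_of_shattersOn hd hZ

theorem Ld_le_pow {d : ℕ} (hd : U.iDim ≤ d) {n : ℕ} (hn : 1 ≤ n) :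
    U.Ld n ≤ ((2 * (4 * n) ^ d : ℕ) : ℕ∞) :=
  Ld_le fun G hG => (card_patterns_profiles_le hd G).trans (Nat.pow_le_pow_left (by omega) d)

theorem exists_card_patterns_eq_two_pow (h : U.iDim = ⊤) (n : ℕ) :
    ∃ G : Finset U.F, G.card = n ∧ (patterns G U.profiles).card = 2 ^ n := by
  obtain ⟨G, rfl, hG⟩ := le_iDim_iff.1 (h ▸ le_top : (n : ℕ∞) ≤ U.iDim)
  exact ⟨G, rfl, by rw [hG.patterns_eq, Finset.card_powerset]⟩

theorem hd_eq_of_iDim_eq_top (h : U.iDim = ⊤) {n : ℕ} (hn : 1 ≤ n) : U.hd n = n := by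
  refine (hd_le n).antisymm ?_
  obtain ⟨G, rfl, card_eq⟩ := exists_card_patterns_eq_two_pow h n
  have : 0 < 2 ^ G.card := by positivity
  exact le_hd (Finset.card_pos.1 hn) (by omega)

theorem two_pow_le_La (h : U.iDim = ⊤) {n : ℕ} (hn : 1 ≤ n) :
    ((2 ^ (n + 1) : ℕ) : ℕ∞) ≤ U.La n := by
  obtain ⟨G, rfl, card_eq⟩ := exists_card_patterns_eq_two_pow h n
  rw [pow_succ', ← card_eq]
  exact two_mul_card_patterns_le_La (Finset.card_pos.1 hn)

end InfoSystem

/-! ### Coverage and linear depth -/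

namespace TreeNode

variable {α : Type u}

/-- The tree with a single path, along which the equations `ξ` are read. -/
def chain (d : ℕ+) : List (α × Bool) → TreeNode α
  | [] => .terminal d
  | e :: ξ => .working e.1 0 (fun _ => e.2) fun _ => chain d ξ

theorem depth_chain (d : ℕ+) (ξ : List (α × Bool)) : (chain d ξ).depth = ξ.length := by
  induction ξ with
  | nil => rfl
  | cons e ξ ih => simp [chain, depth, ih, add_comm]

theorem accepts_chain {d d' : ℕ+} {ξ : List (α × Bool)} {δ : α → Bool} :
    (chain d ξ).Accepts δ d' ↔ Satisfies δ ξ ∧ d' = d := by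
  induction ξ with
  | nil => simp [chain]
  | cons e ξ ih => simp [chain, accepts_working, ih, and_assoc]

end TreeNode

namespace InfoSystem

variable {U : InfoSystem.{u}} {m : ℕ} {B : Set U.A}

theorem solutions_cons (e : U.F × Bool) (ξ : List (U.F × Bool)) :
    U.solutions (e :: ξ) = U.solutions ξ ∩ {a | e.1.1 a = e.2} := by
  ext a
  simp [solutions, and_comm]

theorem isMSet_iff :
    U.IsMSet m B ↔ B.Nonempty ∧ ∃ ξ : List (U.F × Bool), ξ.length = m ∧ U.solutions ξ = B := by
  refine and_congr_right fun _ => ⟨?_, ?_⟩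
  · rintro ⟨f, δ, rfl⟩
    refine ⟨List.ofFn fun i => (f i, δ i), List.length_ofFn, ?_⟩
    ext a
    simp [solutions, List.mem_ofFn]
  · rintro ⟨ξ, rfl, rfl⟩
    refine ⟨fun i => ξ[i].1, fun i => ξ[i].2, ?_⟩
    ext a
    simp only [solutions, List.forall_mem_iff_getElem]
    exact ⟨fun h i => h i.1 i.2, fun h i hi => h ⟨i, hi⟩⟩

theorem isMSet_solutions {ξ : List (U.F × Bool)} {e : U.F × Bool} (length_le : ξ.length ≤ m)
    (nonempty : (U.solutions ξ).Nonempty) (he : ∀ a ∈ U.solutions ξ, e.1.1 a = e.2) :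
    U.IsMSet m (U.solutions ξ) := by
  refine isMSet_iff.2 ⟨nonempty, ξ ++ List.replicate (m - ξ.length) e, by simp; omega, ?_⟩
  ext a
  simp only [solutions, List.mem_append, or_imp, forall_and]
  exact and_iff_left_of_imp fun h e' he' => by rw [List.eq_of_mem_replicate he', he a h]

theorem isMSet_succ_iff : U.IsMSet (m + 1) B ↔ B.Nonempty ∧
    ∃ (B' : Set U.A) (e : U.F × Bool), U.IsMSet m B' ∧ B = B' ∩ {a | e.1.1 a = e.2} := by
  rw [isMSet_iff]
  refine and_congr_right fun hB => ⟨?_, ?_⟩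
  · rintro ⟨_ | ⟨e, ξ⟩, length_eq, rfl⟩
    · cases length_eq
    rw [solutions_cons] at hB ⊢
    exact ⟨_, e, isMSet_iff.2 ⟨hB.mono Set.inter_subset_left, ξ, by simpa using length_eq, rfl⟩,
      rfl⟩
  · rintro ⟨B', e, hB', rfl⟩
    obtain ⟨-, ξ, rfl, rfl⟩ := isMSet_iff.1 hB'
    exact ⟨e :: ξ, rfl, solutions_cons e ξ⟩

/-- `C` is a cover of `B` by `(m,U)`-sets contained in `B`. -/
def IsMCover (m : ℕ) (B : Set U.A) (C : Set (Set U.A)) : Prop := (∀ D ∈ C, U.IsMSet m D) ∧ B = ⋃₀ C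

/-- The predicate `P j` expresses a bound on the number of sets in a family; the bounds of interest
are finiteness and `t ^ j` for a constant `t`. -/
theorem IsMSet.exists_isMCover {P : ℕ → Set (Set U.A) → Prop} (singleton : ∀ B, P 0 {B})
    (empty : P 1 ∅)
    (biUnion : ∀ j C (c : Set U.A → Set (Set U.A)), P j C → (∀ D, P 1 (c D)) →
      P (j + 1) (⋃ D ∈ C, c D))
    (h : ∀ B, U.IsMSet (m + 1) B → ∃ C, P 1 C ∧ IsMCover m B C) {j : ℕ}
    (hB : U.IsMSet (m + j) B) : ∃ C, P j C ∧ IsMCover m B C := by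
  induction j generalizing B with
  | zero => exact ⟨{B}, singleton B, by simpa using hB, by simp⟩
  | succ j ih =>
    obtain ⟨-, B', e, hB', rfl⟩ := isMSet_succ_iff.1 hB
    obtain ⟨C, hPC, mSet, rfl⟩ := ih hB'
    have cover (D : Set U.A) : ∃ c, P 1 c ∧ (D ∈ C → IsMCover m (D ∩ {a | e.1.1 a = e.2}) c) := by
      rcases (D ∩ {a | e.1.1 a = e.2}).eq_empty_or_nonempty with eq | nonempty
      · exact ⟨∅, empty, fun _ => ⟨by simp, by simp [eq]⟩⟩
      by_cases hD : D ∈ C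
      · obtain ⟨c, hc⟩ := h _ (isMSet_succ_iff.2 ⟨nonempty, D, e, mSet D hD, rfl⟩)
        exact ⟨c, hc.1, fun _ => hc.2⟩
      · exact ⟨∅, empty, fun h => absurd h hD⟩
    choose c hPc hc using cover
    refine ⟨⋃ D ∈ C, c D, biUnion j C c hPC hPc, ?_, ?_⟩
    · intro E hE
      obtain ⟨D, hD, hE⟩ := Set.mem_iUnion₂.1 hE
      exact (hc D hD).1 E hE
    · rw [Set.sUnion_eq_biUnion, Set.iUnion₂_inter, Set.iUnion₂_congr fun D hD => (hc D hD).2,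
        Set.sUnion_iUnion]
      exact Set.iUnion_congr fun D => (Set.sUnion_iUnion _).symm

theorem Problem.ha_le_of_cover {z : U.Problem} {C : Set (Set U.A)} (finite : C.Finite)
    (mSet : ∀ D ∈ C, U.IsMSet m D) (covers : ∀ a, ∃ D ∈ C, a ∈ D)
    (const : ∀ D ∈ C, ∀ a ∈ D, ∀ b ∈ D, z.value a = z.value b) : z.ha ≤ m := by
  have := U.infinite_A
  obtain ⟨D₀, hD₀, -⟩ := covers (Classical.arbitrary U.A)
  have := finite.fintype
  have : Nonempty C := ⟨⟨D₀, hD₀⟩⟩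
  obtain ⟨k, hk⟩ := Nat.exists_eq_succ_of_ne_zero (Fintype.card_ne_zero (α := C))
  have e : Fin (k + 1) ≃ C := (Fintype.equivFinOfCardEq hk).symm
  choose nonempty ξ length_eq solutions_eq using fun D : C => isMSet_iff.1 (mSet D.1 D.2)
  let Γ : U.Tree := ⟨k, fun i => .chain (z.value (nonempty (e i)).some) (ξ (e i))⟩
  have accepts_iff (a : U.A) (i : Fin (k + 1)) (d : ℕ+) :
      (Γ.child i).Accepts (profile a) d ↔ a ∈ (e i).1 ∧ d = z.value a := by
    have mem_iff : Satisfies (profile a) (ξ (e i)) ↔ a ∈ (e i).1 :=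
      Set.ext_iff.1 (solutions_eq (e i)) a
    refine TreeNode.accepts_chain.trans ((and_congr_left' mem_iff).trans ?_)
    exact and_congr_right fun ha => by rw [const _ (e i).2 _ (nonempty (e i)).some_mem a ha]
  have solves : SolvesNondet Γ z := solvesNondet_iff.2
    ⟨fun a => by
      obtain ⟨D, hD, ha⟩ := covers a
      exact ⟨e.symm ⟨D, hD⟩, (accepts_iff _ _ _).2 ⟨by simpa using ha, rfl⟩⟩,
    fun a i d h => ((accepts_iff a i d).1 h).2⟩
  have depth_le : Γ.depth ≤ m :=
    Finset.sup_le fun i _ => ((TreeNode.depth_chain _ _).trans (length_eq _)).le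
  exact (iInf₂_le Γ solves).trans (by exact_mod_cast depth_le)

theorem Coverage.exists_ha_le (h : U.Coverage) : ∃ c : ℕ, 0 < c ∧ ∀ n, U.ha n ≤ c := by
  obtain ⟨m, hm, h⟩ := h
  refine ⟨m, hm, fun n => iSup₂_le fun z _ => ?_⟩
  rcases le_total z.dim m with dim_le | le_dim
  · exact z.ha_le_hd.trans (z.hd_le_dim.trans (by exact_mod_cast dim_le))
  obtain ⟨j, dim_eq⟩ := Nat.exists_eq_add_of_le le_dim
  let fiber (x : Fin z.dim → Bool) : Set U.A := {b | ∀ i, (z.f i).1 b = x i}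
  have cover (x) : ∃ C : Set (Set U.A), C.Finite ∧ IsMCover m (fiber x) C := by
    rcases (fiber x).eq_empty_or_nonempty with eq | nonempty
    · exact ⟨∅, Set.finite_empty, by simp, by simp [eq]⟩
    have mSet : U.IsMSet z.dim (fiber x) := ⟨nonempty, z.f, x, rfl⟩
    exact IsMSet.exists_isMCover (P := fun _ => Set.Finite) Set.finite_singleton Set.finite_empty
      (fun _ _ _ hC hc => hC.biUnion fun D _ => hc D) h (dim_eq ▸ mSet)
  choose C finite mSet fiber_eq using cover
  refine Problem.ha_le_of_cover (Set.finite_iUnion finite) (fun D hD => ?_) (fun a => ?_)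
    fun D hD a ha b hb => ?_
  · exact (Set.mem_iUnion.1 hD).elim fun x hD => mSet x D hD
  · have ha : a ∈ ⋃₀ C fun i => (z.f i).1 a := fiber_eq _ ▸ fun i => rfl
    exact ha.imp fun D hD => ⟨Set.mem_iUnion.2 ⟨_, hD.1⟩, hD.2⟩
  · obtain ⟨x, hx⟩ := Set.mem_iUnion.1 hD
    have eq_x (c) (hc : c ∈ D) : (fun i => (z.f i).1 c) = x :=
      funext (fiber_eq x ▸ ⟨D, hx, hc⟩ : c ∈ fiber x)
    exact congrArg z.ν ((eq_x a ha).trans (eq_x b hb).symm)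

theorem IsMSet.exists_recognizing_problem {n : ℕ} (hn : 1 ≤ n) (hB : U.IsMSet n B) :
    ∃ z : U.Problem, z.dim = n ∧ ∀ a, z.value a = 1 ↔ a ∈ B := by
  obtain ⟨-, f, δ, rfl⟩ := hB
  refine ⟨⟨n, hn, fun x => if x = δ then 1 else 2, f⟩, rfl, fun a => ?_⟩
  by_cases h : (fun i => (f i).1 a) = δ
  · simp [Problem.value, h, ← funext_iff]
  · simp [Problem.value, h, ← funext_iff]

/-- The paths to the terminal nodes labelled `1` yield a cover. -/
theorem exists_isMCover_of_depth_le {z : U.Problem} {Γ : U.Tree} (hB : U.IsMSet (m + 1) B)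
    (hz : ∀ a, z.value a = 1 ↔ a ∈ B) (solves : SolvesNondet Γ z) (depth_le : Γ.depth ≤ m) :
    ∃ C ⊆ (fun p => U.solutions p.1) '' Γ.paths, IsMCover m B C := by
  have solutions_subset {ξ} (path : Γ.IsPath ξ 1) : U.solutions ξ ⊆ B := fun a ha =>
    (hz a).1 (solves.2 a ξ 1 path ha).symm
  obtain ⟨-, B', e, -, B_eq⟩ := isMSet_succ_iff.1 hB
  refine ⟨(fun p => U.solutions p.1) '' {p ∈ Γ.paths | p.2 = 1 ∧ (U.solutions p.1).Nonempty},
    Set.image_mono (Set.sep_subset _ _), ?_, Set.Subset.antisymm (fun a ha => ?_) ?_⟩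
  · rintro _ ⟨⟨ξ, d⟩, ⟨path, rfl, nonempty⟩, rfl⟩
    exact isMSet_solutions (path.length_le_depth.trans depth_le) nonempty fun a ha =>
      (B_eq ▸ solutions_subset path ha : a ∈ B' ∩ {a | e.1.1 a = e.2}).2
  · obtain ⟨ξ, d, path, ha'⟩ := solves.1 a
    obtain rfl : d = 1 := (solves.2 a ξ d path ha').trans ((hz a).2 ha)
    exact ⟨_, ⟨(ξ, 1), ⟨path, rfl, a, ha'⟩, rfl⟩, ha'⟩
  · rintro a ⟨_, ⟨⟨ξ, d⟩, ⟨path, rfl, -⟩, rfl⟩, ha⟩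
    exact solutions_subset path ha

theorem le_ha_of_not_isMCover (hB : U.IsMSet (m + 1) B) (h : ∀ C, C.Finite → ¬ IsMCover m B C) :
    ((m + 1 : ℕ) : ℕ∞) ≤ U.ha (m + 1) := by
  obtain ⟨z, dim_eq, hz⟩ := hB.exists_recognizing_problem (Nat.succ_pos m)
  refine le_iSup₂_of_le z dim_eq.le (le_iInf₂ fun Γ solves => ?_)
  by_contra! lt
  obtain ⟨C, subset, cover⟩ :=
    exists_isMCover_of_depth_le hB hz solves (Nat.lt_succ_iff.1 (by exact_mod_cast lt))
  exact h C ((Γ.finite_paths.image _).subset subset) cover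

theorem le_hd_of_not_isMCover (hB : U.IsMSet (m + 1) B)
    (h : ∀ C, C.encard ≤ ((2 ^ m : ℕ) : ℕ∞) → ¬ IsMCover m B C) :
    ((m + 1 : ℕ) : ℕ∞) ≤ U.hd (m + 1) := by
  obtain ⟨z, dim_eq, hz⟩ := hB.exists_recognizing_problem (Nat.succ_pos m)
  refine le_iSup₂_of_le z dim_eq.le (le_iInf₂ fun Γ solves => ?_)
  by_contra! lt
  have depth_le : Γ.depth ≤ m := Nat.lt_succ_iff.1 (by exact_mod_cast lt)
  obtain ⟨C, subset, cover⟩ := exists_isMCover_of_depth_le hB hz solves.2 depth_le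
  refine h C ?_ cover
  calc C.encard ≤ Γ.paths.encard := (Set.encard_le_encard subset).trans (Set.encard_image_le _ _)
    _ ≤ ((2 ^ Γ.depth : ℕ) : ℕ∞) := solves.1.encard_paths_le
    _ ≤ ((2 ^ m : ℕ) : ℕ∞) := by exact_mod_cast Nat.pow_le_pow_right two_pos depth_le

/-- Every `(0,U)`-set is the whole of `A`, unlike a value class of a nonconstant attribute. -/
theorem exists_isMSet_one_not_isMCover (U : InfoSystem.{u}) :
    ∃ B, U.IsMSet 1 B ∧ ∀ C, ¬ IsMCover 0 B C := by
  obtain ⟨g, hg⟩ := exists_not_determinedBy (U := U) ∅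
  unfold DeterminedBy at hg
  push Not at hg
  obtain ⟨_, ⟨a, rfl⟩, _, ⟨b, rfl⟩, -, ne⟩ := hg
  refine ⟨{c | g.1 c = g.1 a}, ⟨⟨a, rfl⟩, fun _ => g, fun _ => g.1 a, by simp⟩, ?_⟩
  rintro C ⟨mSet, B_eq⟩
  obtain ⟨D, hD, -⟩ : a ∈ ⋃₀ C := B_eq ▸ rfl
  obtain ⟨-, f, δ, D_eq⟩ := mSet D hD
  have hb : b ∈ {c | g.1 c = g.1 a} := B_eq ▸ ⟨D, hD, D_eq ▸ fun i => i.elim0⟩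
  exact ne hb.symm

theorem ha_eq_of_not_coverage (h : ¬ U.Coverage) {n : ℕ} (hn : 1 ≤ n) : U.ha n = n := by
  refine ((ha_le_hd n).trans (hd_le n)).antisymm ?_
  obtain ⟨_ | m, rfl⟩ := Nat.exists_eq_add_of_le' hn
  · obtain ⟨B, hB, notCover⟩ := U.exists_isMSet_one_not_isMCover
    exact le_ha_of_not_isMCover hB fun C _ => notCover C
  · unfold Coverage at h
    push Not at h
    obtain ⟨B, hB, notCover⟩ := h (m + 1) (Nat.succ_pos m)
    exact le_ha_of_not_isMCover hB fun C finite hC => notCover C finite hC.1 hC.2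

theorem hd_eq_of_not_restrictedCoverage (h : ¬ U.RestrictedCoverage) {n : ℕ} (hn : 1 ≤ n) :
    U.hd n = n := by
  refine (hd_le n).antisymm ?_
  obtain ⟨_ | m, rfl⟩ := Nat.exists_eq_add_of_le' hn
  · obtain ⟨B, hB, notCover⟩ := U.exists_isMSet_one_not_isMCover
    exact le_hd_of_not_isMCover hB fun C _ => notCover C
  · unfold RestrictedCoverage at h
    push Not at h
    obtain ⟨B, hB, notCover⟩ := h (m + 1) (2 ^ (m + 1)) (Nat.succ_pos m) Nat.one_le_two_pow
    exact le_hd_of_not_isMCover hB fun C le hC => notCover C le hC.1 hC.2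

theorem RestrictedCoverage.coverage (h : U.RestrictedCoverage) : U.Coverage := by
  obtain ⟨m, t, hm, -, h⟩ := h
  refine ⟨m, hm, fun B hB => ?_⟩
  obtain ⟨C, encard_le, cover⟩ := h B hB
  exact ⟨C, Set.finite_of_encard_le_coe encard_le, cover⟩

end InfoSystem

/-! ### Certificates and logarithmic depth -/

section Certificates

variable {α : Type u} {D : Set (α → Bool)} {K m d q p p' b L L' : ℕ} {δ : α → Bool}
  {G H X Y : Finset α}

/-- The restriction of `δ` to any `K` elements of `G` is realized in `D`; a weakening of `δ ∈ D`. -/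
def LocallyConsistent (K : ℕ) (D : Set (α → Bool)) (G : Finset α) (δ : α → Bool) : Prop :=
  ∀ E ⊆ G, E.card ≤ K → ∃ δ' ∈ D, Set.EqOn δ' δ E

theorem LocallyConsistent.mono (h : LocallyConsistent K D H δ) (hG : G ⊆ H) :
    LocallyConsistent K D G δ := fun E hE => h E (hE.trans hG)

theorem card_patterns_locallyConsistent_le (hd : ∀ Z, ShattersOn D Z → Z.card ≤ d) (hK : d < K)
    (Y : Finset α) : (patterns Y {δ | LocallyConsistent K D Y δ}).card ≤ (Y.card + 1) ^ d := by
  refine card_patterns_le_pow fun Z hZY shatters => ?_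
  by_contra! lt
  obtain ⟨Z', hZ', card_Z'⟩ := Finset.exists_subset_card_eq (Nat.succ_le_of_lt lt)
  have : Z'.card ≤ d := hd Z' fun δ => by
    obtain ⟨δ', consistent, eqOn⟩ := shatters.mono hZ' δ
    obtain ⟨δ'', mem, eqOn'⟩ := consistent Z' (hZ'.trans hZY) (card_Z' ▸ hK)
    exact ⟨δ'', mem, eqOn'.trans eqOn⟩
  omega

/-- `G` is a certificate for `X`: if `δ` is locally consistent on `G`, then some `m` of the
equations `g = δ g` with `g ∈ G` imply, for the members of `D`, all the equations `f = δ f` with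
`f ∈ X`. -/
def Certifies (K m : ℕ) (D : Set (α → Bool)) (G X : Finset α) : Prop :=
  X ⊆ G ∧ ∀ δ, LocallyConsistent K D G δ →
    ∃ E ⊆ G, E.card ≤ m ∧ ∀ δ' ∈ D, Set.EqOn δ' δ E → Set.EqOn δ' δ X

theorem Certifies.biUnion [DecidableEq α] {ι : Type*} {I : Finset ι} {G X : ι → Finset α}
    (h : ∀ i ∈ I, Certifies K m D (G i) (X i)) :
    Certifies K (I.card * m) D (I.biUnion G) (I.biUnion X) := by
  refine ⟨Finset.biUnion_mono fun i hi => (h i hi).1, fun δ hδ => ?_⟩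
  have (i) (hi : i ∈ I) := (h i hi).2 δ (hδ.mono (Finset.subset_biUnion_of_mem G hi))
  choose! E hEG card_E hE using this
  refine ⟨I.biUnion E, Finset.biUnion_mono hEG, Finset.card_biUnion_le_card_mul _ _ _ card_E,
    fun δ' hδ' eqOn f hf => ?_⟩
  obtain ⟨i, hi, hf⟩ := Finset.mem_biUnion.1 hf
  exact hE i hi δ' hδ' (eqOn.mono (Finset.coe_subset.2 (Finset.subset_biUnion_of_mem E hi))) hf

/-- Adjoin to `Y` a certificate for the `m'` decisive elements of `Y`, for each pattern on `Y`. -/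
theorem Certifies.exists_certifies {m' s : ℕ} (h : Certifies K m' D Y X)
    (hs : ∀ X' : Finset α, X'.card ≤ m' → ∃ G, Certifies K m D G X' ∧ G.card ≤ s) :
    ∃ H, Certifies K m D H X ∧
      H.card ≤ Y.card + (patterns Y {δ | LocallyConsistent K D Y δ}).card * s := by
  classical
  set P := patterns Y {δ | LocallyConsistent K D Y δ}
  have (S) (hS : S ∈ P) : ∃ δ, LocallyConsistent K D Y δ ∧ pattern Y δ = S := mem_patterns.1 hS
  choose! ρ consistent pattern_ρ using this
  choose! E hEY card_E hE using fun S (hS : S ∈ P) => h.2 (ρ S) (consistent S hS)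
  choose! G certifies card_G using fun S (hS : S ∈ P) => hs (E S) (card_E S hS)
  refine ⟨Y ∪ P.biUnion G, ⟨h.1.trans Finset.subset_union_left, fun δ hδ => ?_⟩,
    (Finset.card_union_le _ _).trans
      (Nat.add_le_add_left (Finset.card_biUnion_le_card_mul _ _ _ card_G) _)⟩
  have hS : pattern Y δ ∈ P := mem_patterns.2 ⟨δ, hδ.mono Finset.subset_union_left, rfl⟩
  have hG : G (pattern Y δ) ⊆ Y ∪ P.biUnion G :=
    (Finset.subset_biUnion_of_mem G hS).trans Finset.subset_union_right
  have ρ_eqOn : Set.EqOn (ρ (pattern Y δ)) δ Y := pattern_eq_pattern_iff.1 (pattern_ρ _ hS)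
  obtain ⟨F, hFG, card_F, hF⟩ := (certifies _ hS).2 δ (hδ.mono hG)
  refine ⟨F, hFG.trans hG, card_F, fun δ' hδ' eqOn => ?_⟩
  have eqOn_E : Set.EqOn δ' (ρ (pattern Y δ)) (E (pattern Y δ)) :=
    (hF δ' hδ' eqOn).trans (ρ_eqOn.mono (Finset.coe_subset.2 (hEY _ hS))).symm
  exact (hE _ hS δ' hδ' eqOn_E).trans (ρ_eqOn.mono (Finset.coe_subset.2 h.1))

/-- Every set of at most `p` elements has a certificate with at most `2 ^ L` elements. -/
def CertificateBound (K m : ℕ) (D : Set (α → Bool)) (p L : ℕ) : Prop :=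
  ∀ X : Finset α, X.card ≤ p → ∃ G, Certifies K m D G X ∧ G.card ≤ 2 ^ L

theorem exists_eq_biUnion_of_card_le_mul [DecidableEq α] {n : ℕ} (hX : X.card ≤ p * n) :
    ∃ B : Fin n → Finset α, (∀ i, (B i).card ≤ p) ∧ X = Finset.univ.biUnion B := by
  induction n generalizing X with
  | zero => exact ⟨Fin.elim0, fun i => i.elim0, by simpa using hX⟩
  | succ n ih =>
    obtain ⟨T, hTX, card_T⟩ := Finset.exists_subset_card_eq (Nat.min_le_right p X.card)
    obtain ⟨B, card_B, eq⟩ := ih (X := X \ T) (by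
      rw [Finset.card_sdiff_of_subset hTX, card_T]
      rw [mul_add, mul_one] at hX
      omega)
    refine ⟨Fin.cons T B, Fin.cases (by simp [card_T]) card_B, ?_⟩
    rw [← Finset.union_sdiff_of_subset hTX, eq]
    ext
    simp [Fin.exists_fin_succ]

namespace CertificateBound

theorem mono (h : CertificateBound K m D p L) (hp : p' ≤ p) (hL : L ≤ L') :
    CertificateBound K m D p' L' := fun X hX =>
  (h X (hX.trans hp)).imp fun _ hG => ⟨hG.1, hG.2.trans (Nat.pow_le_pow_right two_pos hL)⟩

theorem mul (hq : ∀ Y, (patterns Y {δ | LocallyConsistent K D Y δ}).card ≤ (Y.card + 1) ^ q)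
    (h : CertificateBound K m D p L) (h' : CertificateBound K m D (2 ^ b * m) L') :
    CertificateBound K m D (p * 2 ^ b) ((b + L + 1) * (q + 1) + L') := by
  classical
  intro X hX
  obtain ⟨B, card_B, rfl⟩ := exists_eq_biUnion_of_card_le_mul hX
  choose G certifies card_G using fun i => h (B i) (card_B i)
  obtain ⟨H, hH, card_H⟩ := (Certifies.biUnion (I := Finset.univ) fun i _ => certifies i)
    |>.exists_certifies (m := m) (by simpa [CertificateBound] using h')
  refine ⟨H, hH, card_H.trans ?_⟩
  set Y := Finset.univ.biUnion G
  have card_Y : Y.card ≤ 2 ^ (b + L) := by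
    refine (Finset.card_biUnion_le_card_mul _ _ (2 ^ L) fun i _ => card_G i).trans_eq ?_
    rw [Finset.card_fin, pow_add]
  have card_Y_succ : Y.card + 1 ≤ 2 ^ (b + L + 1) := by
    have : 1 ≤ 2 ^ (b + L) := Nat.one_le_two_pow
    linarith [pow_succ 2 (b + L)]
  calc Y.card + (patterns Y {δ | LocallyConsistent K D Y δ}).card * 2 ^ L'
      ≤ 2 ^ (b + L) + (2 ^ (b + L + 1)) ^ q * 2 ^ L' := by
        gcongr
        exact (hq Y).trans (Nat.pow_le_pow_left card_Y_succ q)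
    _ ≤ 2 ^ ((b + L + 1) * q + (b + L) + L') + 2 ^ ((b + L + 1) * q + (b + L) + L') := by
        rw [← pow_mul, ← pow_add]
        gcongr ?_ + ?_ <;> exact Nat.pow_le_pow_right two_pos (by omega)
    _ = 2 ^ ((b + L + 1) * (q + 1) + L') := by ring

theorem iterate {ℓ : ℕ}
    (hq : ∀ Y, (patterns Y {δ | LocallyConsistent K D Y δ}).card ≤ (Y.card + 1) ^ q)
    (h : CertificateBound K m D (2 ^ ℓ * m) L) (k : ℕ) :
    CertificateBound K m D (2 ^ (k * ℓ) * m) (L + k * ((k * ℓ + L + 1) * (q + 1))) := by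
  induction k with
  | zero => exact h.mono (by gcongr <;> simp) (by simp)
  | succ k ih =>
    refine (h.mul hq ih).mono (by rw [add_mul, pow_add]; apply le_of_eq; ring) ?_
    have : (k * ℓ + L + 1) * (q + 1) ≤ ((k + 1) * ℓ + L + 1) * (q + 1) := by gcongr; omega
    nlinarith

end CertificateBound

end Certificates

section CertificateExistence

variable {α : Type u} {D : Set (α → Bool)} {K m p s : ℕ} {δ : α → Bool} {G X : Finset α}

/-- The set of attributes that occur in a system of equations. -/
def occurringAttrs [DecidableEq α] (ξ : List (α × Bool)) : Finset α := (ξ.map Prod.fst).toFinset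

theorem mem_occurringAttrs [DecidableEq α] {ξ : List (α × Bool)} {e : α × Bool} (he : e ∈ ξ) :
    e.1 ∈ occurringAttrs ξ := List.mem_toFinset.2 (List.mem_map_of_mem he)

theorem card_occurringAttrs_le [DecidableEq α] (ξ : List (α × Bool)) :
    (occurringAttrs ξ).card ≤ ξ.length :=
  (List.toFinset_card_le _).trans_eq (List.length_map _)

theorem LocallyConsistent.exists_satisfies [DecidableEq α] {C : Finset (List (α × Bool))}
    (hX : X ⊆ G) (hG : ∀ ξ ∈ C, occurringAttrs ξ ⊆ G) (hK : X.card + C.card ≤ K)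
    (cover : ∀ δ' ∈ D, Set.EqOn δ' δ X → ∃ ξ ∈ C, Satisfies δ' ξ)
    (hδ : LocallyConsistent K D G δ) : ∃ ξ ∈ C, Satisfies δ ξ := by
  by_contra! unsatisfied
  simp only [Satisfies] at unsatisfied
  push Not at unsatisfied
  choose e mem ne using unsatisfied
  set E := C.attach.image fun ξ => (e ξ.1 ξ.2).1
  have hEG : E ⊆ G := Finset.image_subset_iff.2 fun ξ _ =>
    hG ξ.1 ξ.2 (mem_occurringAttrs (mem ξ.1 ξ.2))
  have card_E : E.card ≤ C.card := Finset.card_image_le.trans_eq Finset.card_attach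
  obtain ⟨δ', hδ', eqOn⟩ := hδ (X ∪ E) (Finset.union_subset hX hEG)
    ((Finset.card_union_le _ _).trans (by omega))
  obtain ⟨ξ, hξ, sat⟩ := cover δ' hδ'
    (eqOn.mono (Finset.coe_subset.2 Finset.subset_union_left))
  have hE : (e ξ hξ).1 ∈ X ∪ E := Finset.mem_union_right _
    (Finset.mem_image.2 ⟨⟨ξ, hξ⟩, Finset.mem_attach _ _, rfl⟩)
  exact ne ξ hξ ((eqOn hE).symm.trans (sat _ (mem ξ hξ)))

theorem exists_certificateBound (hK : p + s ≤ K)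
    (cover : ∀ (X : Finset α) (δ : α → Bool), X.card ≤ p → ∃ C : Finset (List (α × Bool)),
      C.card ≤ s ∧ (∀ ξ ∈ C, ξ.length ≤ m) ∧
        ∀ δ' ∈ D, Set.EqOn δ' δ X ↔ ∃ ξ ∈ C, Satisfies δ' ξ) :
    ∃ L, CertificateBound K m D p L := by
  classical
  -- `S ⊆ X` encodes the system of equations on `X` that its indicator function satisfies.
  refine ⟨p + 2 ^ p * (s * m), fun X hX => ?_⟩
  choose C card_C length_le hC using fun S : Finset α => cover X (fun f => decide (f ∈ S)) hX
  have card_attrs (S) (ξ) (hξ : ξ ∈ C S) : (occurringAttrs ξ).card ≤ m :=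
    (card_occurringAttrs_le ξ).trans (length_le S ξ hξ)
  set H := X.powerset.biUnion fun S => (C S).biUnion occurringAttrs
  have card_H : H.card ≤ 2 ^ p * (s * m) :=
    calc H.card ≤ X.powerset.card * (s * m) := Finset.card_biUnion_le_card_mul _ _ _ fun S _ =>
          (Finset.card_biUnion_le_card_mul _ _ m (card_attrs S)).trans
            (Nat.mul_le_mul_right m (card_C S))
      _ ≤ 2 ^ p * (s * m) := by
          rw [Finset.card_powerset]
          exact Nat.mul_le_mul_right _ (Nat.pow_le_pow_right two_pos hX)
  refine ⟨X ∪ H, ⟨Finset.subset_union_left, fun δ hδ => ?_⟩,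
    ((Finset.card_union_le X H).trans (Nat.add_le_add hX card_H)).trans Nat.lt_two_pow_self.le⟩
  have eqOn : Set.EqOn (fun f => decide (f ∈ pattern X δ)) δ X := fun f hf => by
    simp [pattern, Finset.mem_coe.1 hf]
  have attrs_subset (ξ) (hξ : ξ ∈ C (pattern X δ)) : occurringAttrs ξ ⊆ X ∪ H := fun f hf =>
    Finset.mem_union_right _ (Finset.mem_biUnion.2 ⟨_, Finset.mem_powerset.2
      (Finset.filter_subset _ _), Finset.mem_biUnion.2 ⟨ξ, hξ, hf⟩⟩)
  obtain ⟨ξ, hξ, sat⟩ := hδ.exists_satisfies Finset.subset_union_left attrs_subset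
    ((Nat.add_le_add hX (card_C _)).trans hK)
    fun δ' hδ' h => (hC _ δ' hδ').1 (h.trans eqOn.symm)
  refine ⟨occurringAttrs ξ, attrs_subset ξ hξ, card_attrs _ ξ hξ, fun δ' hδ' h => ?_⟩
  refine ((hC _ δ' hδ').2 ⟨ξ, hξ, fun e he => ?_⟩).trans eqOn
  exact (h (mem_occurringAttrs he)).trans (sat e he)

end CertificateExistence

namespace InfoSystem

variable {U : InfoSystem.{u}}

theorem IsMSet.exists_isMCover_encard_le {m t j : ℕ}
    (cover : ∀ B, U.IsMSet (m + 1) B → ∃ C : Set (Set U.A), C.encard ≤ t ∧ IsMCover m B C)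
    {B : Set U.A} (hB : U.IsMSet (m + j) B) :
    ∃ C : Set (Set U.A), C.encard ≤ ((t ^ j : ℕ) : ℕ∞) ∧ IsMCover m B C := by
  refine hB.exists_isMCover (P := fun j C => C.encard ≤ ((t ^ j : ℕ) : ℕ∞)) (by simp) (by simp)
    (fun j C c hC hc => ?_) (by simpa using cover)
  lift C to Finset (Set U.A) using Set.finite_of_encard_le_coe hC
  rw [Set.encard_coe_eq_coe_finsetCard, Nat.cast_le] at hC
  have hc' (D) : (c D).encard ≤ t := by simpa using hc D
  calc (⋃ D ∈ C, c D).encard ≤ ∑ D ∈ C, (c D).encard := C.set_encard_biUnion_le c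
    _ ≤ C.card • (t : ℕ∞) := Finset.sum_le_card_nsmul _ _ _ fun D _ => hc' D
    _ ≤ ((t ^ (j + 1) : ℕ) : ℕ∞) := by
        rw [nsmul_eq_mul, pow_succ]
        exact_mod_cast Nat.mul_le_mul_right t hC

theorem RestrictedCoverage.exists_uniform_cover (h : U.RestrictedCoverage) :
    ∃ m s : ℕ, 1 ≤ m ∧ ∀ (X : Finset U.F) (δ : U.F → Bool), X.card ≤ 2 * m →
      ∃ C : Finset (List (U.F × Bool)), C.card ≤ s ∧ (∀ ξ ∈ C, ξ.length ≤ m) ∧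
        ∀ δ' ∈ U.profiles, Set.EqOn δ' δ X ↔ ∃ ξ ∈ C, Satisfies δ' ξ := by
  classical
  obtain ⟨m, t, hm, ht, cover⟩ := h
  refine ⟨m, t ^ m, hm, fun X δ hX => ?_⟩
  rcases X.eq_empty_or_nonempty with rfl | ⟨f, hf⟩
  · exact ⟨{[]}, by simpa using Nat.one_le_pow m t ht, by simp, by simp⟩
  set ξ := X.toList.map fun f => (f, δ f)
  have mem_solutions (a) : a ∈ U.solutions ξ ↔ Set.EqOn (profile a) δ X := by
    simp only [solutions, ξ, List.forall_mem_map, Finset.mem_toList]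
    rfl
  rcases (U.solutions ξ).eq_empty_or_nonempty with empty | nonempty
  · refine ⟨∅, by simp, by simp, Set.forall_mem_range.2 fun a => ?_⟩
    rw [← mem_solutions, empty]
    simp
  have hB : U.IsMSet (m + m) (U.solutions ξ) :=
    isMSet_solutions (e := (f, δ f)) (by simp [ξ]; omega) nonempty
      fun a ha => (mem_solutions a).1 ha hf
  obtain ⟨C, encard_le, mSet, eq⟩ := hB.exists_isMCover_encard_le cover
  lift C to Finset (Set U.A) using Set.finite_of_encard_le_coe encard_le
  rw [Set.encard_coe_eq_coe_finsetCard, Nat.cast_le] at encard_le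
  choose! system length_eq solutions_eq using fun B hB => (isMSet_iff.1 (mSet B hB)).2
  refine ⟨C.image system, Finset.card_image_le.trans encard_le,
    Finset.forall_mem_image.2 fun B hB => (length_eq B hB).le, Set.forall_mem_range.2 fun a => ?_⟩
  rw [← mem_solutions, eq, Set.mem_sUnion, Finset.exists_mem_image]
  exact exists_congr fun B => and_congr_right fun hB => Set.ext_iff.1 (solutions_eq B hB).symm a

end InfoSystem

section MajorityAnswers

variable {α : Type u} {D D' : Set (α → Bool)} {K k m : ℕ} {δ₀ : α → Bool} {G X : Finset α}

theorem Certifies.anti (h : Certifies K m D G X) (hD : D' ⊆ D) : Certifies K m D' G X :=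
  ⟨h.1, fun δ hδ =>
    have ⟨E, hEG, card_E, hE⟩ := h.2 δ fun E hEG card_E =>
      (hδ E hEG card_E).imp fun _ => And.imp_left fun h => hD h
    ⟨E, hEG, card_E, fun δ' hδ' => hE δ' (hD hδ')⟩⟩

theorem DeterminedBy.anti {β : Type*} {v : (α → Bool) → β} (h : DeterminedBy D X v)
    (hD : D' ⊆ D) : DeterminedBy D' X v := fun δ hδ δ' hδ' => h δ (hD hδ) δ' (hD hδ')

theorem locallyConsistent_of_mul_card_patterns_lt (hD : D.Nonempty)
    (h : ∀ g ∈ G, K * (patterns G {δ ∈ D | δ g = !δ₀ g}).card < (patterns G D).card) :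
    LocallyConsistent K D G δ₀ := by
  intro E hEG card_E
  by_contra! disagree
  have cover : D ⊆ ⋃ g ∈ E, {δ ∈ D | δ g = !δ₀ g} := fun δ hδ => by
    have := disagree δ hδ
    simp only [Set.EqOn] at this
    push Not at this
    obtain ⟨g, hg, ne⟩ := this
    exact Set.mem_biUnion (Finset.mem_coe.1 hg) ⟨hδ, Bool.eq_not.2 ne⟩
  have hE : E.Nonempty := by
    rw [Finset.nonempty_iff_ne_empty]
    rintro rfl
    simpa using cover hD.some_mem
  refine lt_irrefl (K * (patterns G D).card) ?_
  calc K * (patterns G D).card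
      ≤ K * ∑ g ∈ E, (patterns G {δ ∈ D | δ g = !δ₀ g}).card :=
        Nat.mul_le_mul_left K ((Finset.card_le_card (patterns_mono cover)).trans
          (card_patterns_biUnion_le E _))
    _ < ∑ _g ∈ E, (patterns G D).card := by
        rw [Finset.mul_sum]
        exact Finset.sum_lt_sum_of_nonempty hE fun g hg => h g (hEG hg)
    _ ≤ K * (patterns G D).card := by
        rw [Finset.sum_const, smul_eq_mul]
        exact Nat.mul_le_mul_right _ card_E

theorem exists_majority (D : Set (α → Bool)) (G : Finset α) : ∃ δ₀ : α → Bool, ∀ g,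
    (patterns G {δ ∈ D | δ g = !δ₀ g}).card ≤ (patterns G {δ ∈ D | δ g = δ₀ g}).card := by
  choose δ₀ hδ₀ using fun g : α => show ∃ x : Bool, (patterns G {δ ∈ D | δ g = !x}).card ≤
      (patterns G {δ ∈ D | δ g = x}).card from
    (le_total (patterns G {δ ∈ D | δ g = true}).card (patterns G {δ ∈ D | δ g = false}).card).elim
      (fun h => ⟨false, h⟩) fun h => ⟨true, h⟩
  exact ⟨δ₀, hδ₀⟩

theorem succ_mul_card_patterns_le_of_majority {g : α} {y : Bool} (hg : g ∈ G)
    (majority : (patterns G {δ ∈ D | δ g = !y}).card ≤ (patterns G {δ ∈ D | δ g = y}).card)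
    (balanced : (patterns G D).card ≤ (k + 1) * (patterns G {δ ∈ D | δ g = !y}).card) (x : Bool) :
    (k + 1) * (patterns G {δ ∈ D | δ g = x}).card ≤ k * (patterns G D).card := by
  have sum_eq : (patterns G D).card =
      (patterns G {δ ∈ D | δ g = x}).card + (patterns G {δ ∈ D | δ g = !x}).card := by
    rw [card_patterns_eq_sum hg, Fintype.sum_bool]
    cases x
    · exact add_comm _ _
    · rfl
  have minority_le : (patterns G {δ ∈ D | δ g = !y}).card ≤
      (patterns G {δ ∈ D | δ g = !x}).card := by
    rcases Bool.eq_or_eq_not x y with rfl | rfl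
    · exact le_rfl
    · simpa using majority
  nlinarith

namespace TreeNode

variable {v : (α → Bool) → ℕ+}

theorem exists_computes_of_deviations {E : Finset α} {h : ℕ}
    (deviation : ∀ g ∈ E, ∃ t : TreeNode α, t.depth ≤ h ∧ t.Computes {δ ∈ D | δ g = !δ₀ g} v)
    (const : DeterminedBy {δ ∈ D | Set.EqOn δ δ₀ E} ∅ v) :
    ∃ t : TreeNode α, t.depth ≤ h + E.card ∧ t.Computes D v := by
  classical
  induction E using Finset.induction_on generalizing D with
  | empty =>
    obtain ⟨d, hd⟩ := exists_computes_terminal (D := D) (v := v) fun δ hδ δ' hδ' =>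
      const δ ⟨hδ, by simp⟩ δ' ⟨hδ', by simp⟩ (by simp)
    exact ⟨_, Nat.zero_le _, hd⟩
  | insert g E hg ih =>
    obtain ⟨t, depth_t, ht⟩ := deviation g (Finset.mem_insert_self g E)
    obtain ⟨s, depth_s, hs⟩ := ih (D := {δ ∈ D | δ g = δ₀ g})
      (fun f hf => (deviation f (Finset.mem_insert_of_mem hf)).imp fun _ =>
        And.imp_right fun h => h.mono fun _ hδ => ⟨hδ.1.1, hδ.2⟩)
      (const.anti fun _ hδ => ⟨hδ.1.1, eqOn_insert.2 ⟨hδ.1.2, hδ.2⟩⟩)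
    rw [Finset.card_insert_of_notMem hg, ← add_assoc]
    refine ⟨branch g fun x => if x = δ₀ g then s else t, depth_branch_le g fun x => ?_,
      .branch fun x => ?_⟩
    · split <;> omega
    · split <;> rename_i hx
      · rwa [hx]
      · rwa [Bool.eq_not.2 hx]

/-- If some query in `G` always discards at least the proportion `1 / (k + 1)` of the patterns on
`G`, ask it. Otherwise the majority answers are locally consistent and some `m` of them determine
`v`: query those, and each deviation from them leaves less than the proportion `1 / (k + 1)`. -/
theorem exists_computes_of_certifies (hk : 1 ≤ k) (hm : 1 ≤ m) {j : ℕ}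
    (hG : Certifies (k + 1) m D G X) (hv : DeterminedBy D X v)
    (card_lt : (patterns G D).card * k ^ j < (k + 1) ^ j) :
    ∃ t : TreeNode α, t.depth ≤ m * j ∧ t.Computes D v := by
  induction j generalizing D with
  | zero =>
    have hD : D = ∅ := Set.not_nonempty_iff_eq_empty.1 fun hD => by
      rw [pow_zero, pow_zero, mul_one, Nat.lt_one_iff] at card_lt
      exact (patterns_nonempty hD).card_ne_zero card_lt
    obtain ⟨d, hd⟩ := exists_computes_terminal (D := D) (v := v) (by simp [hD])
    exact ⟨_, Nat.zero_le _, hd⟩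
  | succ j ih =>
    rcases D.eq_empty_or_nonempty with rfl | hD
    · obtain ⟨d, hd⟩ := exists_computes_terminal (D := ∅) (v := v) (by simp)
      exact ⟨_, Nat.zero_le _, hd⟩
    set N := fun (g : α) (x : Bool) => (patterns G {δ ∈ D | δ g = x}).card
    have solve (g) (x) (h : (k + 1) * N g x ≤ k * (patterns G D).card) :
        ∃ t : TreeNode α, t.depth ≤ m * j ∧ t.Computes {δ ∈ D | δ g = x} v := by
      refine ih (hG.anti fun _ hδ => hδ.1) (hv.anti fun _ hδ => hδ.1)
        (lt_of_mul_lt_mul_left (a := k + 1) ?_ (Nat.zero_le _))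
      calc (k + 1) * (N g x * k ^ j) = (k + 1) * N g x * k ^ j := (mul_assoc _ _ _).symm
        _ ≤ k * (patterns G D).card * k ^ j := Nat.mul_le_mul_right _ h
        _ = (patterns G D).card * k ^ (j + 1) := by ring
        _ < (k + 1) ^ (j + 1) := card_lt
        _ = (k + 1) * (k + 1) ^ j := pow_succ' _ _
    obtain ⟨δ₀, majority⟩ := exists_majority D G
    by_cases balanced : ∃ g ∈ G, (patterns G D).card ≤ (k + 1) * N g (!δ₀ g)
    · obtain ⟨g, hg, balanced⟩ := balanced
      choose t depth_t ht using fun x =>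
        solve g x (succ_mul_card_patterns_le_of_majority hg (majority g) balanced x)
      exact ⟨branch g t, (depth_branch_le g depth_t).trans (by rw [mul_add]; omega), .branch ht⟩
    · push Not at balanced
      obtain ⟨E, hEG, card_E, hE⟩ :=
        hG.2 δ₀ (locallyConsistent_of_mul_card_patterns_lt hD balanced)
      obtain ⟨t, depth_t, ht⟩ := exists_computes_of_deviations (E := E) (δ₀ := δ₀) (h := m * j)
        (fun g hg => solve g _ ((balanced g (hEG hg)).le.trans (Nat.le_mul_of_pos_left _ hk)))
        fun δ hδ δ' hδ' _ => hv δ hδ.1 δ' hδ'.1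
          ((hE δ hδ.1 hδ.2).trans (hE δ' hδ'.1 hδ'.2).symm)
      exact ⟨t, depth_t.trans (by rw [mul_add]; omega), ht⟩

end TreeNode

end MajorityAnswers

theorem two_mul_pow_self_le {k : ℕ} (hk : 1 ≤ k) : 2 * k ^ k ≤ (k + 1) ^ k := by
  have hk0 : (0 : ℝ) < k := by exact_mod_cast hk
  have bernoulli := one_add_mul_le_pow (a := (1 / k : ℝ)) (by linarith [one_div_pos.2 hk0]) k
  rw [mul_one_div_cancel hk0.ne', one_add_one_eq_two, one_add_div hk0.ne', div_pow,
    le_div_iff₀ (by positivity)] at bernoulli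
  exact_mod_cast bernoulli

theorem pow_log_le_rpow {θ ε x : ℝ} {k i : ℕ} (hθ : 0 ≤ θ) (hε : 0 ≤ ε)
    (hk : θ ≤ (k : ℝ) ^ (1 + ε)) (hx : (k : ℝ) ^ i ≤ x) : θ ^ i ≤ x ^ (1 + ε) :=
  calc θ ^ i ≤ ((k : ℝ) ^ (1 + ε)) ^ i := pow_le_pow_left₀ hθ hk i
    _ = ((k : ℝ) ^ i) ^ (1 + ε) := by
        rw [← Real.rpow_mul_natCast (by positivity), mul_comm,
          Real.rpow_natCast_mul (by positivity)]
    _ ≤ x ^ (1 + ε) := Real.rpow_le_rpow (by positivity) hx (by positivity)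

namespace CertificateBound

variable {α : Type u} {D : Set (α → Bool)} {K m q L₁ : ℕ}

theorem tower {k : ℕ} (hk : 1 ≤ k)
    (hq : ∀ Y, (patterns Y {δ | LocallyConsistent K D Y δ}).card ≤ (Y.card + 1) ^ q)
    (h : CertificateBound K m D (2 * m) L₁) (i : ℕ) :
    CertificateBound K m D (2 ^ k ^ i * m) ((k + 1 + L₁) * (3 * (k * (q + 1))) ^ i) := by
  induction i with
  | zero => exact h.mono (by simp) (by simp)
  | succ i ih =>
    refine (ih.iterate hq k).mono (by rw [pow_succ']) ?_
    set r := k * (q + 1)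
    set T := (3 * r) ^ i with hT
    set c := k + 1 + L₁
    have hr : k ≤ r := Nat.le_mul_of_pos_right k (Nat.succ_pos q)
    have pow_le : k ^ i ≤ T := Nat.pow_le_pow_left (by omega) i
    have one_le : 1 ≤ T := (Nat.one_le_pow i k hk).trans pow_le
    have le_cT : k * k ^ i + 1 ≤ c * T :=
      calc k * k ^ i + 1 ≤ k * T + T := by gcongr
        _ = (k + 1) * T := by ring
        _ ≤ c * T := Nat.mul_le_mul_right T (Nat.le_add_right _ _)
    calc c * T + k * ((k * k ^ i + c * T + 1) * (q + 1))
        = c * T + r * ((k * k ^ i + 1) + c * T) := by ring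
      _ ≤ r * (c * T) + r * (c * T + c * T) := by
          have le_r := Nat.le_mul_of_pos_left (c * T) (hk.trans hr)
          exact Nat.add_le_add le_r (Nat.mul_le_mul_left r (Nat.add_le_add_right le_cT _))
      _ = c * (3 * r) ^ (i + 1) := by rw [pow_succ, ← hT]; ring

/-- The number `k` of iterations per level is chosen so large that the factor `3 * k * (q + 1)`
gained in the logarithm at each level is at most `k ^ (1 + ε)`. -/
theorem exists_le_logb_rpow (hm : 1 ≤ m)
    (hq : ∀ Y, (patterns Y {δ | LocallyConsistent K D Y δ}).card ≤ (Y.card + 1) ^ q)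
    (h : CertificateBound K m D (2 * m) L₁) {ε : ℝ} (hε : 0 < ε) :
    ∃ c : ℝ, 0 ≤ c ∧ ∀ n : ℕ, 2 ≤ n →
      ∃ L : ℕ, (L : ℝ) ≤ c * Real.logb 2 n ^ (1 + ε) ∧ CertificateBound K m D n L := by
  obtain ⟨k, le_rpow, two_le⟩ : ∃ k : ℕ, (3 * (q + 1) : ℝ) ≤ (k : ℝ) ^ ε ∧ 2 ≤ k :=
    ((((tendsto_rpow_atTop hε).comp tendsto_natCast_atTop_atTop).eventually_ge_atTop _).and
      (Filter.eventually_ge_atTop 2)).exists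
  have θ_le : ((3 * (k * (q + 1)) : ℕ) : ℝ) ≤ (k : ℝ) ^ (1 + ε) := by
    rw [Real.rpow_add (by positivity), Real.rpow_one]
    push_cast
    nlinarith
  refine ⟨(k + 1 + L₁) * (3 * (k * (q + 1)) : ℕ), by positivity, fun n hn => ?_⟩
  set ℓ := Nat.log 2 n
  set i := Nat.log k ℓ
  have hℓ : ℓ ≠ 0 := (Nat.log_pos one_lt_two hn).ne'
  have pow_le : (k : ℝ) ^ i ≤ Real.logb 2 n :=
    calc (k : ℝ) ^ i ≤ ℓ := by exact_mod_cast Nat.pow_log_le_self k hℓ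
      _ ≤ Real.logb 2 n := by exact_mod_cast Real.natLog_le_logb n 2
  have le_pow : n ≤ 2 ^ k ^ (i + 1) * m :=
    calc n ≤ 2 ^ (ℓ + 1) := (Nat.lt_pow_succ_log_self one_lt_two n).le
      _ ≤ 2 ^ k ^ (i + 1) :=
        Nat.pow_le_pow_right two_pos (Nat.lt_pow_succ_log_self two_le ℓ)
      _ ≤ 2 ^ k ^ (i + 1) * m := Nat.le_mul_of_pos_right _ hm
  refine ⟨_, ?_, (h.tower (one_le_two.trans two_le) hq (i + 1)).mono le_pow le_rfl⟩
  have := pow_log_le_rpow (Nat.cast_nonneg _) hε.le θ_le pow_le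
  rw [pow_succ', ← mul_assoc]
  push_cast at this ⊢
  gcongr

end CertificateBound

namespace InfoSystem

variable {U : InfoSystem.{u}}

theorem hd_le_of_certificateBound {k m d n L : ℕ} (hk : 1 ≤ k) (hm : 1 ≤ m) (hd : U.iDim ≤ d)
    (h : CertificateBound (k + 1) m U.profiles n L) :
    U.hd n ≤ ((m * (k * ((L + 1) * d + 1)) : ℕ) : ℕ∞) := by
  refine iSup₂_le fun z hz => ?_
  obtain ⟨G, certifies, card_G⟩ := h z.attrs (z.card_attrs_le.trans hz)
  set r := (L + 1) * d + 1
  have card_patterns_lt : (patterns G U.profiles).card < 2 ^ r :=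
    calc (patterns G U.profiles).card ≤ (G.card + 1) ^ d := card_patterns_profiles_le hd G
      _ ≤ (2 ^ (L + 1)) ^ d := by
          gcongr
          linarith [pow_succ 2 L, Nat.one_le_two_pow (n := L)]
      _ = 2 ^ ((L + 1) * d) := (pow_mul _ _ _).symm
      _ < 2 ^ r := Nat.pow_lt_pow_right one_lt_two (Nat.lt_succ_self _)
  obtain ⟨t, depth_le, ht⟩ := TreeNode.exists_computes_of_certifies (j := k * r) hk hm certifies
    (z.determinedBy_attrs _) <|
    calc (patterns G U.profiles).card * k ^ (k * r) < 2 ^ r * k ^ (k * r) :=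
          Nat.mul_lt_mul_of_pos_right card_patterns_lt (by positivity)
      _ = (2 * k ^ k) ^ r := by rw [mul_pow, ← pow_mul]
      _ ≤ ((k + 1) ^ k) ^ r := Nat.pow_le_pow_left (two_mul_pow_self_le hk) r
      _ = (k + 1) ^ (k * r) := (pow_mul _ _ _).symm
  exact (Problem.hd_le_depth ht).trans (by exact_mod_cast depth_le)

theorem RestrictedCoverage.exists_hd_le (h : U.RestrictedCoverage) {d : ℕ} (hd : U.iDim ≤ d)
    {ε : ℝ} (hε : 0 < ε) :
    ∃ c : ℝ, 0 < c ∧ ∀ n : ℕ, 2 ≤ n →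
      ∃ k : ℕ, U.hd n ≤ k ∧ (k : ℝ) ≤ c * Real.logb 2 n ^ (1 + ε) := by
  classical
  obtain ⟨m, s, hm, cover⟩ := h.exists_uniform_cover
  set k := 2 * m + s + d
  have hk : 1 ≤ k := by omega
  obtain ⟨L₁, base⟩ := exists_certificateBound (K := k + 1) (by omega) cover
  obtain ⟨c, hc, bound⟩ := base.exists_le_logb_rpow hm (card_patterns_locallyConsistent_le
    (fun _ => card_le_of_shattersOn hd) (by omega)) hε
  refine ⟨m * (k * ((c + 1) * d + 1)), by positivity, fun n hn => ?_⟩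
  obtain ⟨L, hL, hb⟩ := bound n hn
  refine ⟨_, hd_le_of_certificateBound hk hm hd hb, ?_⟩
  have one_le_logb : 1 ≤ Real.logb 2 n := by
    rw [Real.le_logb_iff_rpow_le one_lt_two (by positivity), Real.rpow_one]
    exact_mod_cast hn
  set y := Real.logb 2 n ^ (1 + ε)
  have hy : 1 ≤ y := Real.one_le_rpow one_le_logb (by positivity)
  push_cast
  calc (m : ℝ) * (k * ((L + 1) * d + 1)) ≤ m * (k * ((c * y + y) * d + y)) := by gcongr
    _ = m * (k * ((c + 1) * d + 1)) * y := by ring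

theorem describes_log {d : ℕ} (hd : U.iDim ≤ d) (h : U.RestrictedCoverage) :
    DetDepthType.LOG.Describes U.hd := by
  intro ε hε _
  obtain ⟨c, hc, le_rpow⟩ := h.exists_hd_le hd hε
  refine ⟨c, hc, fun n hn => ?_⟩
  obtain ⟨k, hk⟩ := ENat.ne_top_iff_exists.1 (ne_top_of_le_ne_top (ENat.natCast_ne_top n)
    (U.hd_le n))
  refine ⟨k, hk.symm, ?_, ?_⟩
  · rw [Real.logb_le_iff_le_rpow one_lt_two (by positivity), Real.rpow_natCast]
    exact_mod_cast lt_two_pow_of_hd_le hn hk.ge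
  · rcases hn.eq_or_lt with rfl | hn
    · have : k ≤ 1 := by exact_mod_cast hk.trans_le (U.hd_le 1)
      rw [Nat.cast_one, Real.logb_one, Real.zero_rpow (by positivity)]
      simpa using this
    · obtain ⟨k', hd_le, k'_le⟩ := le_rpow n hn
      have : (k : ℝ) ≤ k' := by exact_mod_cast hk.trans_le hd_le
      linarith

theorem describes_pol {d : ℕ} (hd : U.iDim = d) :
    SizeType.POL.Describes U.iDim U.Ld ∧ SizeType.POL.Describes U.iDim U.La :=
  have lower {n} (hn : 1 ≤ n) := two_mul_succ_le_La U hn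
  have upper {n} (hn : 1 ≤ n) := Ld_le_pow hd.le hn
  ⟨⟨d, hd, fun n hn => ⟨(lower hn).trans (La_le_Ld n), upper hn⟩⟩,
    ⟨d, hd, fun n hn => ⟨lower hn, (La_le_Ld n).trans (upper hn)⟩⟩⟩

end InfoSystem

/-! ### Types of behavior -/

section Types

open Filter Asymptotics

theorem DetDepthType.Describes.not_lin_of_log {h : ℕ → ℕ∞} (hLog : LOG.Describes h) :
    ¬ LIN.Describes h := by
  intro hLin
  obtain ⟨c, -, bound⟩ := hLog (1 / 2) (by norm_num) (by norm_num)
  have isLittleO : (fun x : ℝ => c * Real.logb 2 x ^ (1 + 1 / 2 : ℝ) + 1) =o[atTop] id := by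
    refine .add (.const_mul_left ?_ c) (isLittleO_const_id_atTop 1)
    have := (isLittleO_log_rpow_rpow_atTop (1 + 1 / 2) one_pos).const_mul_left
      (Real.log 2 ^ (1 + 1 / 2 : ℝ))⁻¹
    refine this.congr' ?_ (by simp [EventuallyEq])
    filter_upwards [eventually_ge_atTop 1] with x hx
    rw [Real.logb, Real.div_rpow (Real.log_nonneg hx) (Real.log_nonneg one_le_two),
      div_eq_inv_mul (Real.log x ^ _)]
  obtain ⟨n, le_half, hn⟩ := (((isLittleO.comp_tendsto tendsto_natCast_atTop_atTop).bound
    one_half_pos).and (eventually_ge_atTop 1)).exists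
  obtain ⟨k, hk, -, k_le⟩ := bound n hn
  obtain rfl : n = k := by exact_mod_cast (hLin n hn).symm.trans hk
  have : (1 : ℝ) ≤ n := by exact_mod_cast hn
  have := (le_abs_self _).trans le_half
  simp only [Function.comp_apply, id_eq, Real.norm_natCast] at this
  linarith

theorem DetDepthType.Describes.unique {h : ℕ → ℕ∞} :
    ∀ {x y : DetDepthType}, x.Describes h → y.Describes h → x = y
  | LOG, LOG, _, _ => rfl
  | LIN, LIN, _, _ => rfl
  | LOG, LIN, hx, hy => (hx.not_lin_of_log hy).elim
  | LIN, LOG, hx, hy => (hy.not_lin_of_log hx).elim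

theorem NondetDepthType.Describes.not_lin_of_con {h : ℕ → ℕ∞} (hCon : CON.Describes h) :
    ¬ LIN.Describes h := by
  intro hLin
  obtain ⟨c, -, bound⟩ := hCon
  have := bound (c + 1) c.succ_pos
  rw [hLin _ c.succ_pos, Nat.cast_le] at this
  exact c.not_succ_le_self this

theorem NondetDepthType.Describes.unique {h : ℕ → ℕ∞} :
    ∀ {x y : NondetDepthType}, x.Describes h → y.Describes h → x = y
  | CON, CON, _, _ => rfl
  | LIN, LIN, _, _ => rfl
  | CON, LIN, hx, hy => (hx.not_lin_of_con hy).elim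
  | LIN, CON, hx, hy => (hy.not_lin_of_con hx).elim

theorem SizeType.Describes.not_exp_of_pol {I : ℕ∞} {L : ℕ → ℕ∞} (hPol : POL.Describes I L) :
    ¬ EXP.Describes I L := by
  intro hExp
  obtain ⟨d, -, bound⟩ := hPol
  have isLittleO : (fun n : ℕ => 4 ^ d * (n : ℝ) ^ d) =o[atTop] fun n => (2 : ℝ) ^ n :=
    (isLittleO_pow_const_const_pow_of_one_lt d one_lt_two).const_mul_left _
  obtain ⟨n, le_half, hn⟩ :=
    ((isLittleO.bound one_half_pos).and (eventually_ge_atTop 1)).exists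
  have two_pow_le := (bound n hn).2
  rw [hExp n hn, Nat.cast_le, pow_succ'] at two_pow_le
  have : (2 ^ n : ℝ) ≤ 4 ^ d * n ^ d := by
    rw [← mul_pow]
    exact_mod_cast le_of_mul_le_mul_left two_pow_le two_pos
  have : (0 : ℝ) < 2 ^ n := by positivity
  rw [Real.norm_of_nonneg (by positivity), Real.norm_of_nonneg (by positivity)] at le_half
  linarith

theorem SizeType.Describes.unique {I : ℕ∞} {L : ℕ → ℕ∞} :
    ∀ {x y : SizeType}, x.Describes I L → y.Describes I L → x = y
  | POL, POL, _, _ => rfl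
  | EXP, EXP, _, _ => rfl
  | POL, EXP, hx, hy => (hx.not_exp_of_pol hy).elim
  | EXP, POL, hx, hy => (hy.not_exp_of_pol hx).elim

end Types

namespace InfoSystem

variable {U : InfoSystem.{u}}

theorem HasType.unique {σ τ : SystemType} (hσ : U.HasType σ) (hτ : U.HasType τ) : σ = τ :=
  (SystemType.mk.injEq ..).mpr ⟨hσ.1.unique hτ.1, hσ.2.1.unique hτ.2.1,
    hσ.2.2.1.unique hτ.2.2.1, hσ.2.2.2.unique hτ.2.2.2⟩

theorem Coverage.describes_con (h : U.Coverage) : NondetDepthType.CON.Describes U.ha :=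
  let ⟨c, hc, ha_le⟩ := h.exists_ha_le
  ⟨c, hc, fun n _ => ha_le n⟩

theorem describes_exp (h : U.iDim = ⊤) :
    SizeType.EXP.Describes U.iDim U.Ld ∧ SizeType.EXP.Describes U.iDim U.La :=
  ⟨fun n hn => (Ld_le_two_pow n).antisymm ((two_pow_le_La h hn).trans (La_le_Ld n)),
    fun n hn => ((La_le_Ld n).trans (Ld_le_two_pow n)).antisymm (two_pow_le_La h hn)⟩

theorem hasType_typeTable_zero (hI : U.iDim ≠ ⊤) (h : U.RestrictedCoverage) :
    U.HasType (typeTable 0) :=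
  have ⟨_, hd⟩ := ENat.ne_top_iff_exists.1 hI
  ⟨describes_log hd.ge h, h.coverage.describes_con, describes_pol hd.symm⟩

theorem hasType_typeTable_one (hI : U.iDim ≠ ⊤) (h : U.Coverage) (h' : ¬ U.RestrictedCoverage) :
    U.HasType (typeTable 1) :=
  have ⟨_, hd⟩ := ENat.ne_top_iff_exists.1 hI
  ⟨fun _ => hd_eq_of_not_restrictedCoverage h', h.describes_con, describes_pol hd.symm⟩

theorem hasType_typeTable_two (hI : U.iDim ≠ ⊤) (h : ¬ U.Coverage) : U.HasType (typeTable 2) :=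
  have ⟨_, hd⟩ := ENat.ne_top_iff_exists.1 hI
  ⟨fun _ => hd_eq_of_not_restrictedCoverage (mt RestrictedCoverage.coverage h),
    fun _ => ha_eq_of_not_coverage h, describes_pol hd.symm⟩

theorem hasType_typeTable_three (hI : U.iDim = ⊤) (h : U.Coverage) : U.HasType (typeTable 3) :=
  ⟨fun _ => hd_eq_of_iDim_eq_top hI, h.describes_con, describes_exp hI⟩

theorem hasType_typeTable_four (hI : U.iDim = ⊤) (h : ¬ U.Coverage) : U.HasType (typeTable 4) :=
  ⟨fun _ => hd_eq_of_iDim_eq_top hI, fun _ => ha_eq_of_not_coverage h, describes_exp hI⟩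

theorem HasType.iff_eq {σ τ : SystemType} (hσ : U.HasType σ) : U.HasType τ ↔ τ = σ :=
  ⟨fun hτ => hτ.unique hσ, fun h => h ▸ hσ⟩

theorem exists_hasType_iff (U : InfoSystem.{u}) : ∃ i : Fin 5,
    (∀ τ : SystemType, U.HasType τ ↔ τ = typeTable i) ∧
    ((typeTable i).hd = .LOG ↔ U.iDim ≠ ⊤ ∧ U.RestrictedCoverage) ∧
    ((typeTable i).ha = .CON ↔ U.Coverage) ∧
    ((typeTable i).Ld = .POL ↔ U.iDim ≠ ⊤) := by
  by_cases hI : U.iDim = ⊤ <;> by_cases hC : U.Coverage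
  · exact ⟨3, fun _ => (hasType_typeTable_three hI hC).iff_eq, by simp [typeTable, hI, hC]⟩
  · exact ⟨4, fun _ => (hasType_typeTable_four hI hC).iff_eq, by simp [typeTable, hI, hC]⟩
  · by_cases hR : U.RestrictedCoverage
    · exact ⟨0, fun _ => (hasType_typeTable_zero hI hR).iff_eq, by simp [typeTable, hI, hC, hR]⟩
    · exact ⟨1, fun _ => (hasType_typeTable_one hI hC hR).iff_eq, by simp [typeTable, hI, hC, hR]⟩
  · exact ⟨2, fun _ => (hasType_typeTable_two hI hC).iff_eq,
      by simp [typeTable, hI, hC, mt RestrictedCoverage.coverage hC]⟩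

end InfoSystem

/-! ### Examples -/

theorem encard_sUnion_le_of_subsingleton {α : Type*} {C : Set (Set α)}
    (h : ∀ D ∈ C, D.Subsingleton) : (⋃₀ C).encard ≤ C.encard := by
  choose! D hD mem using fun a (ha : a ∈ ⋃₀ C) => ha
  exact Set.encard_le_encard_of_injOn hD fun a ha b hb hab =>
    h _ (hD a ha) (mem a ha) (hab ▸ mem b hb)

namespace InfoSystem

variable {U : InfoSystem.{u}} {m : ℕ} {B D : Set U.A}

theorem iDim_ne_top_of_finite_coloring {κ : Type*} [Finite κ] (c : U.F → κ)
    (h : ∀ f g : U.F, f ≠ g → c f = c g → ∃ x y, ∀ a, f.1 a = x → g.1 a ≠ y) : U.iDim ≠ ⊤ := by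
  classical
  intro top
  have := Fintype.ofFinite κ
  obtain ⟨G, card_G, shatters⟩ :=
    le_iDim_iff.1 (top ▸ le_top : ((Fintype.card κ + 1 : ℕ) : ℕ∞) ≤ U.iDim)
  obtain ⟨f, hf, g, hg, hne, color_eq⟩ := Finset.exists_ne_map_eq_of_card_lt_of_maps_to
    (s := G) (t := Finset.univ) (f := c) (by simp [card_G]) fun _ _ => Finset.mem_univ _
  obtain ⟨x, y, missing⟩ := h f g hne color_eq
  obtain ⟨-, ⟨a, rfl⟩, eqOn⟩ := shatters fun k => if k = f then x else y
  exact missing a ((eqOn hf).trans (if_pos rfl)) ((eqOn hg).trans (if_neg hne.symm))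

theorem iDim_eq_top_of_infinite {ι : Type*} [Infinite ι] (f : ι → U.F)
    (h : ∀ (s : Finset ι) (δ : ι → Bool), ∃ a, ∀ i ∈ s, (f i).1 a = δ i) : U.iDim = ⊤ := by
  classical
  have injective : Function.Injective f := by
    intro i j hij
    obtain ⟨a, ha⟩ := h {i, j} fun k => decide (k = i)
    have hi := ha i (by simp)
    have hj := ha j (by simp)
    rw [hij, hj] at hi
    simpa [eq_comm] using hi
  refine ENat.eq_top_iff_forall_ge.2 fun n => le_iDim_iff.2 ?_
  obtain ⟨s, rfl⟩ := Infinite.exists_subset_card_eq ι n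
  refine ⟨s.map ⟨f, injective⟩, Finset.card_map _, fun δ => ?_⟩
  obtain ⟨a, ha⟩ := h s (δ ∘ f)
  exact ⟨profile a, ⟨a, rfl⟩, by simpa [Set.EqOn, profile] using ha⟩

theorem isMSet_one {e : U.F × Bool} (nonempty : {a | e.1.1 a = e.2}.Nonempty) :
    U.IsMSet 1 {a | e.1.1 a = e.2} :=
  isMSet_iff.2 ⟨nonempty, [e], rfl, by simp [solutions]⟩

theorem isMSet_card {ι : Type*} (s : Finset ι) (f : ι → U.F) (x : Bool)
    (nonempty : {a | ∀ i ∈ s, (f i).1 a = x}.Nonempty) :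
    U.IsMSet s.card {a | ∀ i ∈ s, (f i).1 a = x} :=
  isMSet_iff.2 ⟨nonempty, s.toList.map fun i => (f i, x), by simp, by simp [solutions]⟩

theorem IsMSet.exists_ne_of_card_lt {ι : Type*} {s : Finset ι} {p : ι → U.A} (hD : U.IsMSet m D)
    (hp : ∀ i ∈ s, p i ∉ D) (card_lt : m < s.card) :
    ∃ f : U.F, ∃ i ∈ s, ∃ j ∈ s, i ≠ j ∧
      ∀ d ∈ D, f.1 (p i) ≠ f.1 d ∧ f.1 (p j) ≠ f.1 d := by
  obtain ⟨-, f, δ, rfl⟩ := hD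
  have violated (i : s) : ∃ r, (f r).1 (p i) ≠ δ r := by simpa using hp i i.2
  choose r hr using violated
  obtain ⟨i, j, hne, hij⟩ := Fintype.exists_ne_map_eq_of_card_lt r (by simpa using card_lt)
  exact ⟨f (r i), i, i.2, j, j.2, Subtype.coe_ne_coe.2 hne,
    fun d hd => hd (r i) ▸ ⟨hr i, hij ▸ hr j⟩⟩

theorem restrictedCoverage_of_isMSet (hm : 1 ≤ m)
    (h : ∀ B, U.IsMSet (m + 1) B → U.IsMSet m B) : U.RestrictedCoverage :=
  ⟨m, 1, hm, le_rfl, fun B hB => ⟨{B}, by simp, by simpa using h B hB, by simp⟩⟩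

theorem coverage_of_isMSet_singleton (hm : 1 ≤ m) (singleton : ∀ a, U.IsMSet m {a})
    (h : ∀ B, U.IsMSet (m + 1) B → ∃ T ⊆ B, U.IsMSet m T ∧ (B \ T).Finite) : U.Coverage := by
  refine ⟨m, hm, fun B hB => ?_⟩
  obtain ⟨T, subset, hT, finite⟩ := h B hB
  refine ⟨insert T ((fun a => {a}) '' (B \ T)), (finite.image _).insert T, ?_, ?_⟩
  · rintro _ (rfl | ⟨a, -, rfl⟩)
    exacts [hT, singleton a]
  · rw [Set.sUnion_insert, Set.sUnion_image, Set.biUnion_of_singleton,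
      Set.union_sdiff_cancel subset]

end InfoSystem

section Examples

open InfoSystem

theorem lAttr_eq_true {n a : ℕ+} : lAttr n a = true ↔ n < a := decide_eq_true_iff

theorem lAttr_eq_false {n a : ℕ+} : lAttr n a = false ↔ a ≤ n :=
  decide_eq_false_iff_not.trans not_lt

theorem pAttr_eq_true {c a : ℕ+} : pAttr c a = true ↔ a = c := decide_eq_true_iff

theorem pAttr_eq_false {c a : ℕ+} : pAttr c a = false ↔ a ≠ c := decide_eq_false_iff_not

theorem exists_missing_lAttr {i j : ℕ+} (h : lAttr i ≠ lAttr j) :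
    ∃ x y, ∀ a, lAttr i a = x → lAttr j a ≠ y := by
  rcases lt_or_gt_of_ne (ne_of_apply_ne lAttr h) with hij | hij
  · refine ⟨false, true, fun a hi hj => ?_⟩
    exact ((lAttr_eq_false.1 hi).trans_lt hij).not_gt (lAttr_eq_true.1 hj)
  · refine ⟨true, false, fun a hi hj => ?_⟩
    exact ((lAttr_eq_false.1 hj).trans_lt hij).not_gt (lAttr_eq_true.1 hi)

theorem exists_missing_pAttr {i j : ℕ+} (h : pAttr i ≠ pAttr j) :
    ∃ x y, ∀ a, pAttr i a = x → pAttr j a ≠ y :=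
  ⟨true, true, fun _ hi hj =>
    ne_of_apply_ne pAttr h ((pAttr_eq_true.1 hi).symm.trans (pAttr_eq_true.1 hj))⟩

theorem iDim_U₁_ne_top : U₁.iDim ≠ ⊤ := by
  refine iDim_ne_top_of_finite_coloring (fun _ => ()) ?_
  rintro ⟨_, i, rfl⟩ ⟨_, j, rfl⟩ hne -
  exact exists_missing_lAttr (Subtype.coe_ne_coe.2 hne)

theorem iDim_U₂_ne_top : U₂.iDim ≠ ⊤ := by
  refine iDim_ne_top_of_finite_coloring (fun f => f.1 ∈ Set.range pAttr) ?_
  rintro ⟨f, hf⟩ ⟨g, hg⟩ hne hcolor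
  replace hne : f ≠ g := Subtype.coe_ne_coe.2 hne
  replace hcolor : f ∈ Set.range pAttr ↔ g ∈ Set.range pAttr := iff_of_eq hcolor
  by_cases hp : f ∈ Set.range pAttr
  · obtain ⟨j, rfl⟩ := hcolor.1 hp
    obtain ⟨i, rfl⟩ := hp
    exact exists_missing_pAttr hne
  · obtain ⟨i, rfl⟩ := hf.resolve_left hp
    obtain ⟨j, rfl⟩ := hg.resolve_left (mt hcolor.2 hp)
    exact exists_missing_lAttr hne

theorem iDim_U₃_ne_top : U₃.iDim ≠ ⊤ := by
  refine iDim_ne_top_of_finite_coloring (fun _ => ()) ?_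
  rintro ⟨_, i, rfl⟩ ⟨_, j, rfl⟩ hne -
  exact exists_missing_pAttr (Subtype.coe_ne_coe.2 hne)

theorem iDim_U₄ : U₄.iDim = ⊤ := by
  let e : ℕ+ ≃ Finset ℕ := Denumerable.equiv₂ ℕ+ (Finset ℕ)
  refine iDim_eq_top_of_infinite (fun i : ℕ => ⟨fun a => decide (i ∈ e a), Set.mem_univ _⟩)
    fun s δ => ⟨e.symm {i ∈ s | δ i = true}, fun i hi => ?_⟩
  simp [hi]

theorem iDim_U₅ : U₅.iDim = ⊤ :=
  iDim_eq_top_of_infinite (fun i : ℕ+ => ⟨coordAttr i, i, rfl⟩) fun _ δ => ⟨δ, fun _ _ => rfl⟩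

theorem exists_inter_eq_U₁ {e e' : U₁.F × Bool} (h : e.2 = e'.2) : ∃ e'' : U₁.F × Bool,
    {a | e.1.1 a = e.2} ∩ {a | e'.1.1 a = e'.2} = {a | e''.1.1 a = e''.2} := by
  obtain ⟨⟨_, i, rfl⟩, x⟩ := e
  obtain ⟨⟨_, j, rfl⟩, _⟩ := e'
  cases h
  cases x
  · refine ⟨(⟨lAttr (min i j), _, rfl⟩, false), Set.ext fun (a : ℕ+) => ?_⟩
    change lAttr i a = false ∧ lAttr j a = false ↔ lAttr (min i j) a = false
    simp only [lAttr_eq_false, le_min_iff]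
  · refine ⟨(⟨lAttr (max i j), _, rfl⟩, true), Set.ext fun (a : ℕ+) => ?_⟩
    change lAttr i a = true ∧ lAttr j a = true ↔ lAttr (max i j) a = true
    simp only [lAttr_eq_true, max_lt_iff]

theorem isMSet_two_U₁_of_eq {e₀ e₁ e₂ : U₁.F × Bool} {B : Set U₁.A} (nonempty : B.Nonempty)
    (hB : B = {a | e₀.1.1 a = e₀.2} ∩ {a | e₁.1.1 a = e₁.2} ∩ {a | e₂.1.1 a = e₂.2})
    (h : e₀.2 = e₁.2) : U₁.IsMSet 2 B := by
  obtain ⟨e, he⟩ := exists_inter_eq_U₁ h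
  rw [he] at hB
  subst hB
  exact isMSet_succ_iff.2 ⟨nonempty, _, e₂, isMSet_one (nonempty.mono Set.inter_subset_left), rfl⟩

/-- Two of any three equations have the same right-hand side, and can be merged into one. -/
theorem restrictedCoverage_U₁ : U₁.RestrictedCoverage := by
  refine restrictedCoverage_of_isMSet one_le_two fun B hB => ?_
  obtain ⟨nonempty, ξ, length_eq, rfl⟩ := isMSet_iff.1 hB
  obtain ⟨e₀, e₁, e₂, rfl⟩ := List.length_eq_three.1 length_eq
  have two_eq : e₀.2 = e₁.2 ∨ e₀.2 = e₂.2 ∨ e₁.2 = e₂.2 := by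
    cases e₀.2 <;> cases e₁.2 <;> cases e₂.2 <;> simp
  have solutions_eq : U₁.solutions [e₀, e₁, e₂] =
      {a | e₀.1.1 a = e₀.2} ∩ {a | e₁.1.1 a = e₁.2} ∩ {a | e₂.1.1 a = e₂.2} := by
    ext a
    simp [solutions, and_assoc]
  rcases two_eq with h | h | h
  · exact isMSet_two_U₁_of_eq nonempty solutions_eq h
  · exact isMSet_two_U₁_of_eq nonempty (solutions_eq.trans (Set.inter_right_comm ..)) h
  · refine isMSet_two_U₁_of_eq (e₂ := e₀) nonempty (solutions_eq.trans ?_) h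
    rw [Set.inter_assoc, Set.inter_comm]

theorem exists_finite_setOf_eq_U₂ (f : U₂.F) : ∃ y, {a | f.1 a = y}.Finite := by
  obtain ⟨_, ⟨c, rfl⟩ | ⟨i, rfl⟩⟩ := f
  · exact ⟨true, (Set.finite_singleton c).subset fun a => pAttr_eq_true.1⟩
  · exact ⟨false, (Set.finite_Iic (2 ^ (i : ℕ) : ℕ+)).subset fun a => lAttr_eq_false.1⟩

theorem finite_or_finite_compl_of_isMSet_U₂ {n : ℕ} {B : Set U₂.A} (hB : U₂.IsMSet n B) :
    B.Finite ∨ Bᶜ.Finite := by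
  induction n generalizing B with
  | zero =>
    obtain ⟨-, -, -, rfl⟩ := hB
    simp
  | succ n ih =>
    obtain ⟨-, B', ⟨f, x⟩, hB', rfl⟩ := isMSet_succ_iff.1 hB
    obtain ⟨y, finite⟩ := exists_finite_setOf_eq_U₂ f
    rcases eq_or_ne x y with rfl | hne
    · exact .inl (finite.subset Set.inter_subset_right)
    · refine (ih hB').imp (·.subset Set.inter_subset_left) fun finite' => ?_
      rw [Set.compl_inter]
      refine finite'.union (finite.subset fun a ha => ?_)
      rw [Bool.eq_not.2 hne] at ha
      simpa using ha

theorem isMSet_singleton_U₂ (c : ℕ+) : U₂.IsMSet 1 ({c} : Set ℕ+) := by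
  have h : {a | pAttr c a = true} = {c} := Set.ext fun _ => pAttr_eq_true
  exact h ▸ isMSet_one (U := U₂) (e := (⟨pAttr c, .inl ⟨c, rfl⟩⟩, true)) ⟨c, pAttr_eq_true.2 rfl⟩

theorem isMSet_Ioi_U₂ (i : ℕ+) : U₂.IsMSet 1 (Set.Ioi (2 ^ (i : ℕ)) : Set ℕ+) := by
  have h : {a | lAttr (2 ^ (i : ℕ)) a = true} = Set.Ioi (2 ^ (i : ℕ)) :=
    Set.ext fun _ => lAttr_eq_true
  exact h ▸ isMSet_one (U := U₂) (e := (⟨lAttr (2 ^ (i : ℕ)), .inr ⟨i, rfl⟩⟩, true))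
    ⟨(2 ^ (i : ℕ) + 1 : ℕ+), lAttr_eq_true.2 (PNat.lt_add_right _ _)⟩

theorem coverage_U₂ : U₂.Coverage := by
  refine coverage_of_isMSet_singleton le_rfl isMSet_singleton_U₂ fun (B : Set ℕ+) hB => ?_
  rcases finite_or_finite_compl_of_isMSet_U₂ hB with finite | finite
  · obtain ⟨b, hb⟩ := hB.1
    exact ⟨{b}, Set.singleton_subset_iff.2 hb, isMSet_singleton_U₂ b, finite.sdiff⟩
  · obtain ⟨N, hN⟩ : ∃ N : ℕ+, ∀ a ∈ Bᶜ, a ≤ N := Set.Finite.bddAbove (α := ℕ+) finite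
    have lt_two_pow : N < 2 ^ (N : ℕ) := by
      rw [← PNat.coe_lt_coe, PNat.pow_coe]
      exact Nat.lt_two_pow_self
    have finite_Iic : (Set.Iic (2 ^ (N : ℕ)) : Set ℕ+).Finite := Set.finite_Iic _
    refine ⟨_, fun (a : ℕ+) ha => ?_, isMSet_Ioi_U₂ N, finite_Iic.subset ?_⟩
    · by_contra ha'
      exact (lt_two_pow.trans ha).not_ge (hN a ha')
    · exact fun a ha => not_lt (α := ℕ+).1 ha.2

/-- Two attributes `l` cut out `(2 ^ i, 2 ^ (i + 1)]`, and `m - 1` attributes `p` remove its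
smallest elements one by one. -/
theorem isMSet_Icc_U₂ (i m : ℕ+)
    (h : (Set.Icc (2 ^ (i : ℕ) + m) (2 ^ (i + 1 : ℕ)) : Set ℕ+).Nonempty) :
    U₂.IsMSet (m + 1) (Set.Icc (2 ^ (i : ℕ) + m) (2 ^ (i + 1 : ℕ)) : Set ℕ+) := by
  induction m using PNat.recOn with
  | one =>
    have Icc_eq : (Set.Icc (2 ^ (i : ℕ) + 1) (2 ^ (i + 1 : ℕ)) : Set ℕ+) =
        Set.Ioi (2 ^ (i : ℕ)) ∩ {a | lAttr (2 ^ (i + 1 : ℕ)) a = false} := Set.ext fun a =>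
      and_congr PNat.add_one_le_iff lAttr_eq_false.symm
    exact isMSet_succ_iff.2 ⟨h, _, (⟨lAttr (2 ^ (i + 1 : ℕ)), .inr ⟨i + 1, rfl⟩⟩, false),
      isMSet_Ioi_U₂ i, Icc_eq⟩
  | succ m ih =>
    have Icc_eq : (Set.Icc (2 ^ (i : ℕ) + (m + 1)) (2 ^ (i + 1 : ℕ)) : Set ℕ+) =
        Set.Icc (2 ^ (i : ℕ) + m) (2 ^ (i + 1 : ℕ)) ∩
          {a | pAttr (2 ^ (i : ℕ) + m) a = false} := by
      ext a
      simp only [Set.mem_Icc, ← add_assoc, PNat.add_one_le_iff, lt_iff_le_and_ne, Set.mem_inter_iff,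
        Set.mem_ofPred_eq, pAttr_eq_false, ne_comm (a := a)]
      tauto
    refine isMSet_succ_iff.2 ⟨h, _, (⟨pAttr (2 ^ (i : ℕ) + m), .inl ⟨_, rfl⟩⟩, false),
      ih (h.mono ?_), Icc_eq⟩
    exact Icc_eq.trans_subset Set.inter_subset_left

theorem eq_of_forall_pAttr_ne {D : Set ℕ+} (hD : D.Nontrivial) {a c : ℕ+}
    (h : ∀ d ∈ D, pAttr c a ≠ pAttr c d) : a = c := by
  obtain ⟨d, hd, hne⟩ := hD.exists_ne c
  have := h d hd
  rwa [pAttr_eq_false.2 hne, ne_eq, Bool.not_eq_false, pAttr_eq_true] at this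

theorem exists_forall_eq_of_lAttr_ne (e : ℕ) {i d : ℕ+}
    (hd : d ∈ Set.Ioc (2 ^ (i : ℕ)) (2 ^ (i + 1 : ℕ))) :
    ∃ c : ℕ+, ∀ a ∈ Set.Icc (2 ^ (i : ℕ)) (2 ^ (i + 1 : ℕ) + 1),
      lAttr (2 ^ e) a ≠ lAttr (2 ^ e) d → a = c := by
  rcases le_or_gt e i with he | he
  · have pow_le : (2 : ℕ+) ^ e ≤ 2 ^ (i : ℕ) := pow_le_pow_right' one_le he
    refine ⟨2 ^ (i : ℕ), fun a ha hne => ?_⟩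
    rw [lAttr_eq_true.2 (pow_le.trans_lt hd.1), ne_eq, Bool.not_eq_true, lAttr_eq_false] at hne
    exact (hne.trans pow_le).antisymm ha.1
  · have le_pow : (2 : ℕ+) ^ (i + 1 : ℕ) ≤ 2 ^ e := pow_le_pow_right' one_le he
    refine ⟨2 ^ (i + 1 : ℕ) + 1, fun a ha hne => ?_⟩
    rw [lAttr_eq_false.2 (hd.2.trans le_pow), ne_eq, Bool.not_eq_false, lAttr_eq_true] at hne
    exact ha.2.antisymm (PNat.add_one_le_iff.2 (le_pow.trans_lt hne))

/-- The `m + 1` points `2 ^ i, …, 2 ^ i + m - 1, 2 ^ (i + 1) + 1` lie outside the interval, but an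
attribute that separates one of them from all of `D` does not separate any other. -/
theorem subsingleton_of_subset_Icc_U₂ {i m : ℕ+} {D : Set ℕ+} (hD : U₂.IsMSet m D)
    (subset : D ⊆ Set.Icc (2 ^ (i : ℕ) + m) (2 ^ (i + 1 : ℕ))) : D.Subsingleton := by
  by_contra! nontrivial
  obtain ⟨d, hd⟩ := nontrivial.nonempty
  have add_le : (2 : ℕ+) ^ (i : ℕ) + m ≤ 2 ^ (i + 1 : ℕ) := (subset hd).1.trans (subset hd).2
  have lt_add : (2 : ℕ+) ^ (i : ℕ) < 2 ^ (i : ℕ) + m := PNat.lt_add_right _ _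
  let s : Finset ℕ+ :=
    insert (2 ^ (i + 1 : ℕ) + 1) (Finset.Ico (2 ^ (i : ℕ)) (2 ^ (i : ℕ) + m))
  have notMem : ∀ a ∈ s, a ∉ D := by
    intro a ha haD
    rcases Finset.mem_insert.1 ha with rfl | ha
    · exact (subset haD).2.not_gt (PNat.lt_add_right _ _)
    · exact (subset haD).1.not_gt (Finset.mem_Ico.1 ha).2
  have mem_Icc : ∀ a ∈ s, a ∈ Set.Icc (2 ^ (i : ℕ)) (2 ^ (i + 1 : ℕ) + 1) := by
    intro a ha
    rcases Finset.mem_insert.1 ha with rfl | ha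
    · exact ⟨(lt_add.le.trans add_le).trans (PNat.lt_add_right _ _).le, le_rfl⟩
    · rw [Finset.mem_Ico] at ha
      exact ⟨ha.1, (ha.2.le.trans add_le).trans (PNat.lt_add_right _ _).le⟩
  have card_s : s.card = m + 1 := by
    rw [Finset.card_insert_of_notMem, PNat.card_Ico, PNat.add_coe, Nat.add_sub_cancel_left]
    exact fun h => (Finset.mem_Ico.1 h).2.not_ge (add_le.trans (PNat.lt_add_right _ _).le)
  obtain ⟨⟨_, ⟨c, rfl⟩ | ⟨e, rfl⟩⟩, a, ha, b, hb, hne, h⟩ :=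
    hD.exists_ne_of_card_lt (p := id) notMem (card_s ▸ Nat.lt_succ_self _)
  · exact hne ((eq_of_forall_pAttr_ne nontrivial fun d hd => (h d hd).1).trans
      (eq_of_forall_pAttr_ne nontrivial fun d hd => (h d hd).2).symm)
  · obtain ⟨c, hc⟩ := exists_forall_eq_of_lAttr_ne e
      ⟨lt_add.trans_le (subset hd).1, (subset hd).2⟩
    exact hne ((hc a (mem_Icc a ha) (h d hd).1).trans (hc b (mem_Icc b hb) (h d hd).2).symm)

theorem not_restrictedCoverage_U₂ : ¬ U₂.RestrictedCoverage := by
  rintro ⟨m, t, hm, -, cover⟩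
  lift m to ℕ+ using hm
  let i : ℕ+ := m + ⟨t + 1, t.succ_pos⟩
  let B : Finset ℕ+ := Finset.Icc (2 ^ (i : ℕ) + m) (2 ^ (i + 1 : ℕ))
  have card_B : t < B.card := by
    have lt_two_pow : m + (t + 1) < 2 ^ (i : ℕ) := Nat.lt_two_pow_self (n := i)
    rw [PNat.card_Icc, PNat.add_coe, PNat.pow_coe, PNat.pow_coe, pow_succ]
    simp only [PNat.val_ofNat]
    omega
  have coe_B : (B : Set ℕ+) = Set.Icc (2 ^ (i : ℕ) + m) (2 ^ (i + 1 : ℕ)) := Finset.coe_Icc _ _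
  have mSet := isMSet_Icc_U₂ i m (coe_B ▸ Finset.card_pos.1 (t.zero_le.trans_lt card_B))
  obtain ⟨C, encard_C, hC, sUnion_eq⟩ := cover _ mSet
  have subsingleton : ∀ D ∈ C, D.Subsingleton := fun D hD =>
    subsingleton_of_subset_Icc_U₂ (hC D hD) (sUnion_eq ▸ Set.subset_sUnion_of_mem hD)
  have encard_B : (B : Set ℕ+).encard ≤ t := by
    rw [coe_B.trans sUnion_eq]
    exact (encard_sUnion_le_of_subsingleton subsingleton).trans encard_C
  rw [Set.encard_coe_eq_coe_finsetCard, Nat.cast_le] at encard_B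
  exact card_B.not_ge encard_B

theorem subsingleton_of_subset_compl_U₃ {m : ℕ} {s : Finset U₃.A} {D : Set U₃.A}
    (hD : U₃.IsMSet m D) (subset : ∀ a ∈ s, a ∉ D) (card_lt : m < s.card) : D.Subsingleton := by
  by_contra! nontrivial
  obtain ⟨⟨_, c, rfl⟩, a, -, b, -, hne, h⟩ := hD.exists_ne_of_card_lt (p := id) subset card_lt
  exact hne ((eq_of_forall_pAttr_ne nontrivial fun d hd => (h d hd).1).trans
    (eq_of_forall_pAttr_ne nontrivial fun d hd => (h d hd).2).symm)

theorem not_coverage_U₃ : ¬ U₃.Coverage := by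
  rintro ⟨m, -, cover⟩
  have := U₃.infinite_A
  obtain ⟨s, card_s⟩ := Infinite.exists_subset_card_eq U₃.A (m + 1)
  let f (i : U₃.A) : U₃.F := ⟨pAttr i, i, rfl⟩
  have compl_eq : {a | ∀ i ∈ s, (f i).1 a = false} = (s : Set U₃.A)ᶜ := Set.ext fun a =>
    ⟨fun h ha => pAttr_eq_false.1 (h a ha) rfl,
      fun h i hi => pAttr_eq_false.2 fun hai => h (hai ▸ hi)⟩
  have infinite : (s : Set U₃.A)ᶜ.Infinite := s.finite_toSet.infinite_compl
  have mSet := isMSet_card s f false (compl_eq ▸ infinite.nonempty)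
  rw [compl_eq, card_s] at mSet
  obtain ⟨C, finite, hC, sUnion_eq⟩ := cover _ mSet
  refine infinite (sUnion_eq ▸ finite.sUnion fun D hD => Set.Subsingleton.finite ?_)
  have subset : D ⊆ (s : Set U₃.A)ᶜ := sUnion_eq ▸ Set.subset_sUnion_of_mem hD
  exact subsingleton_of_subset_compl_U₃ (hC D hD) (fun a ha haD => subset haD ha) (by omega)

theorem coverage_U₄ : U₄.Coverage := by
  classical
  refine (restrictedCoverage_of_isMSet le_rfl fun B hB => ?_).coverage
  have mSet := isMSet_one (U := U₄) (e := (⟨fun a => decide (a ∈ B), Set.mem_univ _⟩, true))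
  simp only [decide_eq_true_eq, Set.ofPred_mem_eq] at mSet
  exact mSet hB.1

theorem not_coverage_U₅ : ¬ U₅.Coverage := by
  rintro ⟨m, -, cover⟩
  obtain ⟨s, card_s⟩ := Infinite.exists_subset_card_eq ℕ+ (m + 1)
  let B : Set U₅.A := {a | ∀ i ∈ s, coordAttr i a = true}
  have mem_B : (fun _ => true) ∈ B := fun _ _ => rfl
  obtain ⟨C, -, hC, sUnion_eq⟩ :=
    cover B (card_s ▸ isMSet_card s (fun i => (⟨coordAttr i, i, rfl⟩ : U₅.F)) true ⟨_, mem_B⟩)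
  obtain ⟨D, hD, mem_D⟩ := (sUnion_eq ▸ mem_B : (fun _ => true) ∈ ⋃₀ C)
  have update_notMem : ∀ i ∈ s, Function.update (fun _ => true) i false ∉ D := fun i hi h => by
    simpa [coordAttr] using (sUnion_eq ▸ Set.subset_sUnion_of_mem hD : D ⊆ B) h i hi
  obtain ⟨⟨_, c, rfl⟩, i, -, j, -, hne, h⟩ :=
    (hC D hD).exists_ne_of_card_lt update_notMem (by omega)
  have eq_of_ne {i : ℕ+} (hi : coordAttr c (Function.update (fun _ => true) i false) ≠ true) :
      c = i := by
    by_contra hci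
    exact hi (Function.update_of_ne hci _ _)
  exact hne ((eq_of_ne (h _ mem_D).1).symm.trans (eq_of_ne (h _ mem_D).2))

end Examples

theorem theorem1 :
    (∀ U : InfoSystem.{u}, ∃ i : Fin 5,
      (∀ τ : SystemType, U.HasType τ ↔ τ = typeTable i) ∧
      ((typeTable i).hd = .LOG ↔ U.iDim ≠ ⊤ ∧ U.RestrictedCoverage) ∧
      ((typeTable i).ha = .CON ↔ U.Coverage) ∧
      ((typeTable i).Ld = .POL ↔ U.iDim ≠ ⊤)) ∧
    U₁.HasType (typeTable 0) ∧
    U₂.HasType (typeTable 1) ∧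
    U₃.HasType (typeTable 2) ∧
    U₄.HasType (typeTable 3) ∧
    U₅.HasType (typeTable 4) :=
  ⟨InfoSystem.exists_hasType_iff,
    InfoSystem.hasType_typeTable_zero iDim_U₁_ne_top restrictedCoverage_U₁,
    InfoSystem.hasType_typeTable_one iDim_U₂_ne_top coverage_U₂ not_restrictedCoverage_U₂,
    InfoSystem.hasType_typeTable_two iDim_U₃_ne_top not_coverage_U₃,
    InfoSystem.hasType_typeTable_three iDim_U₄ coverage_U₄,
    InfoSystem.hasType_typeTable_four iDim_U₅ not_coverage_U₅⟩
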